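/- Let $d,k$ be positive integers. Let $A(\xi)$, $\xi\in\mathbb R^d$, be a measurable function whose values are Hermitian $k\times k$-matrices, and let $P(D)=\Phi^*A\Phi$ be the corresponding self-adjoint operator in $L_2(\mathbb R^d;\mathbb C^k)$, where $(\Phi f)(\xi)=(2\pi)^{-d/2}\int_{\mathbb R^d}e^{-i\langle x,\xi\rangle}f(x)\,dx$ is the unitary Fourier transform, $A$ denotes multiplication by $A(\xi)$, and the domain $\mathcal D(P(D))$ consists of all $f\in L_2(\mathbb R^d;\mathbb C^k)$ such that $A\Phi f\in L_2(\mathbb R^d;\mathbb C^k)$. Suppose that $P(D)$ is strongly Carleman, that is, \[ \nu(\xi):=\min_{\mathbf n\in\mathbb C^k,\ |\mathbf n|=1}|A(\xi)\mathbf n|\to\infty\quad\text{as }|\xi|\to\infty . \] Let $M_0(x)$ and $M(x)$, $x\in\mathbb R^d$, be measurable functions whose values are Hermitian $k\times k$-matrices, such that $0<c_0\le M_0(x)\le c_1<\infty$ and $0<c_0\le M(x)\le c_1<\infty$ for all $x$ and some constants $c_0,c_1$. Let $\mathcal H$ be the space $L_2(\mathbb R^d;\mathbb C^k)$ with the scalar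 product $(f,g)_{\mathcal H}=\int_{\mathbb R^d}\langle M(x)f(x),g(x)\rangle_{\mathbb C^k}\,dx$, and let $\mathcal H_0$ be defined in the same way with $M_0$ in place of $M$. Consider the operators $H=M^{-1}P(D)$ in $\mathcal H$ and $H_0=M_0^{-1}P(D)$ in $\mathcal H_0$ on the common domain $\mathcal D(H)=\mathcal D(H_0)=\mathcal D(P(D))$. If \[ M(x)-M_0(x)\to0\quad\text{as }|x|\to\infty , \] then $\sigma^{ess}(H)=\sigma^{ess}(H_0)$, where the essential spectrum $\sigma^{ess}$ of an operator is its spectrum without isolated eigenvalues of finite multiplicity. -/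

import Mathlib

open MeasureTheory Filter Topology Bornology
open scoped FourierTransform ENNReal

noncomputable section

namespace MediumScattering

open scoped ComplexOrder

/-! ### Spectrum and essential spectrum of an unbounded operator -/

section Spectrum

variable {E : Type*} [NormedAddCommGroup E] [NormedSpace ℂ E]

/-- `z` is a regular point of the unbounded operator `T`: the operator `T - z`, defined on the
domain of `T`, has an everywhere defined bounded (two-sided) inverse `R`. -/
def IsRegularPoint (T : E →ₗ.[ℂ] E) (z : ℂ) : Prop :=
  ∃ R : E →L[ℂ] E,
    (∀ y : E, ∃ h : R y ∈ T.domain, T ⟨R y, h⟩ - z • R y = y) ∧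
    (∀ x : T.domain, R (T x - z • (x : E)) = x)

/-- The spectrum of an unbounded operator. -/
def opSpectrum (T : E →ₗ.[ℂ] E) : Set ℂ := {z | ¬ IsRegularPoint T z}

/-- The eigenspace `{f ∈ 𝓓(T) : T f = z f}`. -/
def eigenspace (T : E →ₗ.[ℂ] E) (z : ℂ) : Submodule ℂ E where
  carrier := {f | ∃ h : f ∈ T.domain, T ⟨f, h⟩ = z • f}
  zero_mem' := ⟨T.domain.zero_mem, by
    rw [smul_zero]; exact T.map_zero⟩
  add_mem' := by
    rintro f g ⟨hf, hf'⟩ ⟨hg, hg'⟩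
    refine ⟨T.domain.add_mem hf hg, ?_⟩
    rw [smul_add, ← hf', ← hg']
    exact T.map_add ⟨f, hf⟩ ⟨g, hg⟩
  smul_mem' := by
    rintro c f ⟨hf, hf'⟩
    refine ⟨T.domain.smul_mem c hf, ?_⟩
    rw [smul_comm, ← hf']
    exact T.map_smul c ⟨f, hf⟩

/-- `z` is an eigenvalue of finite multiplicity of `T` which is an isolated point of the
spectrum of `T`. -/
def IsIsolatedFiniteEigenvalue (T : E →ₗ.[ℂ] E) (z : ℂ) : Prop :=
  eigenspace T z ≠ ⊥ ∧ FiniteDimensional ℂ (eigenspace T z) ∧ ∀ᶠ w in 𝓝[≠] z, w ∉ opSpectrum T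

/-- The essential spectrum: the spectrum without isolated eigenvalues of finite multiplicity. -/
def essentialSpectrum (T : E →ₗ.[ℂ] E) : Set ℂ :=
  {z | z ∈ opSpectrum T ∧ ¬ IsIsolatedFiniteEigenvalue T z}

end Spectrum

/-! ### Multiplication by matrix-functions -/

/-- The space `ℝᵈ` with its Euclidean norm. -/
abbrev Sp (d : ℕ) := EuclideanSpace ℝ (Fin d)

/-- The space `L₂(ℝᵈ; ℂᵏ)`. -/
abbrev L2 (d k : ℕ) := Lp (α := Sp d) (EuclideanSpace ℂ (Fin k)) 2

/-- The action of a `k × k`-matrix on the Euclidean space `ℂᵏ`. -/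
abbrev act {k : ℕ} (B : Matrix (Fin k) (Fin k) ℂ) :
    EuclideanSpace ℂ (Fin k) →L[ℂ] EuclideanSpace ℂ (Fin k) :=
  Matrix.toEuclideanCLM (n := Fin k) (𝕜 := ℂ) B

/-- The maximal domain `{f ∈ L₂ : B f ∈ L₂}` of multiplication by a matrix-function `B`. -/
def mulDomain {d k : ℕ} (B : Sp d → Matrix (Fin k) (Fin k) ℂ) : Submodule ℂ (L2 d k) where
  carrier := {f | MemLp (fun x => act (B x) (f x)) 2 volume}
  zero_mem' := by
    refine (MemLp.zero (μ := volume) (p := 2) (ε := EuclideanSpace ℂ (Fin k))).ae_eq ?_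
    filter_upwards [Lp.coeFn_zero (EuclideanSpace ℂ (Fin k)) 2 (volume : Measure (Sp d))]
      with x hx
    rw [hx, Pi.zero_apply, map_zero]
  add_mem' := by
    intro f g hf hg
    refine (MemLp.add hf hg).ae_eq ?_
    filter_upwards [Lp.coeFn_add f g] with x hx
    rw [hx, Pi.add_apply, Pi.add_apply, map_add]
  smul_mem' := by
    intro c f hf
    refine (MemLp.const_smul hf c).ae_eq ?_
    filter_upwards [Lp.coeFn_smul c f] with x hx
    rw [hx, Pi.smul_apply, Pi.smul_apply, map_smul]

theorem mem_mulDomain {d k : ℕ} {B : Sp d → Matrix (Fin k) (Fin k) ℂ} {f : L2 d k} :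
    f ∈ mulDomain B ↔ MemLp (fun x => act (B x) (f x)) 2 volume := Iff.rfl

/-- The product `B f` as an element of `L₂`. -/
def mulFun {d k : ℕ} (B : Sp d → Matrix (Fin k) (Fin k) ℂ) (f : mulDomain B) : L2 d k :=
  MemLp.toLp (fun x => act (B x) ((f : L2 d k) x)) (mem_mulDomain.1 f.2)

theorem coeFn_mulFun {d k : ℕ} (B : Sp d → Matrix (Fin k) (Fin k) ℂ) (f : mulDomain B) :
    mulFun B f =ᵐ[volume] fun x => act (B x) ((f : L2 d k) x) :=
  MemLp.coeFn_toLp _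

/-- Multiplication by a matrix-function `B` on its maximal domain. -/
def mulOp {d k : ℕ} (B : Sp d → Matrix (Fin k) (Fin k) ℂ) : L2 d k →ₗ.[ℂ] L2 d k where
  domain := mulDomain B
  toFun :=
    { toFun := mulFun B
      map_add' := by
        intro f g
        apply Lp.ext
        filter_upwards [coeFn_mulFun B f, coeFn_mulFun B g, coeFn_mulFun B (f + g),
          Lp.coeFn_add (f : L2 d k) (g : L2 d k), Lp.coeFn_add (mulFun B f) (mulFun B g)]
          with x h1 h2 h3 h4 h5
        rw [h5, Pi.add_apply, h1, h2, h3, Submodule.coe_add, h4, Pi.add_apply, map_add]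
      map_smul' := by
        intro c f
        apply Lp.ext
        filter_upwards [coeFn_mulFun B f, coeFn_mulFun B (c • f),
          Lp.coeFn_smul c (f : L2 d k), Lp.coeFn_smul c (mulFun B f)]
          with x h1 h2 h3 h4
        rw [RingHom.id_apply, h4, Pi.smul_apply, h1, h2, Submodule.coe_smul, h3, Pi.smul_apply,
          map_smul] }

/-- The operator `P(D) = Φ* A Φ` with symbol `A(ξ)`, on the domain of all `f` with
`A (Φ f) ∈ L₂`. Here `(Φ f)(ξ) = (2π)^(-d/2) ∫ exp(-i⟨x, ξ⟩) f(x) dx`. Since Mathlib's Fourier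
transform `𝓕` on `L₂` has the kernel `exp(-2πi⟨x, ξ⟩)`, the operator `Φ* A Φ` is the same as
`𝓕⁻¹ A(2π ·) 𝓕`. -/
def pseudoDiffOp {d k : ℕ} (A : Sp d → Matrix (Fin k) (Fin k) ℂ) : L2 d k →ₗ.[ℂ] L2 d k where
  domain := (mulOp fun ξ => A ((2 * Real.pi) • ξ)).domain.comap
    (Lp.fourierTransformₗᵢ (Sp d) (EuclideanSpace ℂ (Fin k))).toLinearEquiv.toLinearMap
  toFun :=
    (Lp.fourierTransformₗᵢ (Sp d) (EuclideanSpace ℂ (Fin k))).symm.toLinearEquiv.toLinearMap ∘ₗ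
      (mulOp fun ξ => A ((2 * Real.pi) • ξ)).toFun ∘ₗ
      (Lp.fourierTransformₗᵢ (Sp d) (EuclideanSpace ℂ (Fin k))).toLinearEquiv.toLinearMap.restrict
        (fun _ hf => Submodule.mem_comap.1 hf)

/-- `ν(ξ) = min_{|n| = 1} |A(ξ) n|`. -/
def nu {d k : ℕ} (A : Sp d → Matrix (Fin k) (Fin k) ℂ) (ξ : Sp d) : ℝ :=
  ⨅ n : Metric.sphere (0 : EuclideanSpace ℂ (Fin k)) 1, ‖act (A ξ) n‖

/-- `P(D)` is strongly Carleman: `ν(ξ) → ∞` as `|ξ| → ∞`. -/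
def StronglyCarleman {d k : ℕ} (A : Sp d → Matrix (Fin k) (Fin k) ℂ) : Prop :=
  Tendsto (nu A) (cobounded (Sp d)) atTop

/-! ### The medium and the weighted Hilbert space -/

/-- A measurable Hermitian matrix-function `M` with `0 < c₀ ≤ M(x) ≤ c₁ < ∞`. -/
structure Medium (d k : ℕ) where
  /-- the matrix `M(x)` -/
  mat : Sp d → Matrix (Fin k) (Fin k) ℂ
  aemeasurable : ∀ i j, AEMeasurable (fun x => mat x i j) volume
  isHermitian : ∀ x, (mat x).IsHermitian
  bounds : ∃ c₀ c₁ : ℝ, 0 < c₀ ∧ ∀ x,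
    (mat x - (c₀ : ℂ) • (1 : Matrix (Fin k) (Fin k) ℂ)).PosSemidef ∧
    ((c₁ : ℂ) • (1 : Matrix (Fin k) (Fin k) ℂ) - mat x).PosSemidef

section Helpers

variable {d k : ℕ}

theorem memLp_act {B : Sp d → Matrix (Fin k) (Fin k) ℂ}
    (hB : ∀ i j, AEMeasurable (fun x => B x i j) volume) {C : ℝ}
    (hC : ∀ x v, ‖act (B x) v‖ ≤ C * ‖v‖) (f : L2 d k) :
    MemLp (fun x => act (B x) (f x)) 2 volume := by
  refine MemLp.of_le_mul (c := C) (Lp.memLp f) ?_ (Eventually.of_forall fun x => hC x (f x))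
  have hf : AEMeasurable (f : Sp d → EuclideanSpace ℂ (Fin k)) volume :=
    (Lp.aestronglyMeasurable f).aemeasurable
  have h1 : AEMeasurable (fun x => (fun i => ∑ j, B x i j * (f x) j : Fin k → ℂ)) volume := by
    refine aemeasurable_pi_lambda _ fun i => ?_
    refine Finset.aemeasurable_fun_sum _ fun j _ => (hB i j).mul ?_
    exact (EuclideanSpace.proj (𝕜 := ℂ) j).continuous.measurable.comp_aemeasurable hf
  have h2 : AEMeasurable (fun x => act (B x) (f x)) volume :=
    (PiLp.continuous_toLp 2 (fun _ : Fin k => ℂ)).measurable.comp_aemeasurable h1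
  exact h2.aestronglyMeasurable

theorem inner_act_self_re_nonneg {B : Matrix (Fin k) (Fin k) ℂ} (h : B.PosSemidef)
    (v : EuclideanSpace ℂ (Fin k)) : 0 ≤ RCLike.re (inner ℂ v (act B v)) := by
  have := (Matrix.isPositive_toEuclideanLin_iff.2 h).2 v
  rw [inner_re_symm] at this
  exact this

theorem act_sub_smul_one (B : Matrix (Fin k) (Fin k) ℂ) (c : ℂ) (v : EuclideanSpace ℂ (Fin k)) :
    act (B - c • 1) v = act B v - c • v := by
  simp [act]

theorem act_smul_one_sub (B : Matrix (Fin k) (Fin k) ℂ) (c : ℂ) (v : EuclideanSpace ℂ (Fin k)) :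
    act (c • 1 - B) v = c • v - act B v := by
  simp [act]

theorem re_inner_smul_self (c : ℝ) (v : EuclideanSpace ℂ (Fin k)) :
    RCLike.re (inner ℂ v ((c : ℂ) • v)) = c * ‖v‖ ^ 2 := by
  rw [inner_smul_right, ← inner_self_eq_norm_sq (𝕜 := ℂ) v]
  exact Complex.re_ofReal_mul c _

theorem inner_act_ge {B : Matrix (Fin k) (Fin k) ℂ} {c : ℝ}
    (h : (B - (c : ℂ) • (1 : Matrix (Fin k) (Fin k) ℂ)).PosSemidef)
    (v : EuclideanSpace ℂ (Fin k)) :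
    c * ‖v‖ ^ 2 ≤ RCLike.re (inner ℂ v (act B v)) := by
  have := inner_act_self_re_nonneg h v
  rw [act_sub_smul_one, inner_sub_right, map_sub, re_inner_smul_self] at this
  linarith

theorem norm_act_ge {B : Matrix (Fin k) (Fin k) ℂ} {c : ℝ}
    (h : (B - (c : ℂ) • (1 : Matrix (Fin k) (Fin k) ℂ)).PosSemidef)
    (v : EuclideanSpace ℂ (Fin k)) : c * ‖v‖ ≤ ‖act B v‖ := by
  rcases eq_or_ne v 0 with rfl | hv
  · simp
  · have h1 := inner_act_ge h v
    have h2 := (RCLike.re_le_norm (inner ℂ v (act B v))).trans (norm_inner_le_norm v (act B v))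
    have h3 : 0 < ‖v‖ := norm_pos_iff.2 hv
    nlinarith

theorem inner_act_symm {B : Matrix (Fin k) (Fin k) ℂ} (h : B.IsHermitian)
    (v w : EuclideanSpace ℂ (Fin k)) : inner ℂ (act B v) w = inner ℂ v (act B w) :=
  (Matrix.isSymmetric_toEuclideanLin_iff.2 h) v w

namespace Medium

variable (M : Medium d k)

theorem exists_norm_act_le : ∃ C : ℝ, ∀ x v, ‖act (M.mat x) v‖ ≤ C * ‖v‖ := by
  obtain ⟨c₀, c₁, hc₀, h⟩ := M.bounds
  refine ⟨max c₁ 0, fun x v => ?_⟩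
  have hpos : (0 : EuclideanSpace ℂ (Fin k) →L[ℂ] EuclideanSpace ℂ (Fin k)) ≤ act (M.mat x) := by
    rw [ContinuousLinearMap.nonneg_iff_isPositive]
    refine ⟨fun v w => inner_act_symm (M.isHermitian x) v w, fun v => ?_⟩
    have := inner_act_ge (h x).1 v
    rw [inner_re_symm] at this
    exact le_trans (by positivity) this
  have hle : act (M.mat x) ≤ algebraMap ℝ _ (max c₁ 0) := by
    rw [ContinuousLinearMap.le_def]
    refine ⟨fun v w => ?_, fun v => ?_⟩
    · have := inner_act_symm (M.isHermitian x) v w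
      simp_all [inner_sub_left, inner_sub_right, Algebra.algebraMap_eq_smul_one]
    · have h1 := inner_act_self_re_nonneg (h x).2 v
      rw [act_smul_one_sub, inner_re_symm] at h1
      have h2 : c₁ * ‖v‖ ^ 2 ≤ max c₁ 0 * ‖v‖ ^ 2 := by gcongr; exact le_max_left _ _
      rw [inner_sub_left, map_sub] at h1
      simp only [ContinuousLinearMap.reApplyInnerSelf]
      rw [sub_apply, inner_sub_left, map_sub]
      have h3 : RCLike.re (inner ℂ ((c₁ : ℂ) • v) v) = c₁ * ‖v‖ ^ 2 := by
        rw [inner_re_symm, re_inner_smul_self]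
      have h4 : RCLike.re (inner ℂ ((algebraMap ℝ (EuclideanSpace ℂ (Fin k) →L[ℂ]
          EuclideanSpace ℂ (Fin k)) (max c₁ 0)) v) v) = max c₁ 0 * ‖v‖ ^ 2 := by
        rw [Algebra.algebraMap_eq_smul_one, smul_apply,
          one_apply_eq_self, inner_smul_left_eq_smul, inner_self_eq_norm_sq_to_K]
        norm_cast
      linarith
  have := (CStarAlgebra.norm_le_iff_le_algebraMap (act (M.mat x)) (le_max_right c₁ 0) hpos).2 hle
  exact (act (M.mat x)).le_of_opNorm_le this v

theorem isUnit_det (x : Sp d) : IsUnit (M.mat x).det := by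
  obtain ⟨c₀, c₁, hc₀, h⟩ := M.bounds
  rw [← Matrix.isUnit_iff_isUnit_det, ← Matrix.mulVec_injective_iff_isUnit]
  intro v w hvw
  have h1 := norm_act_ge (h x).1 (WithLp.toLp 2 (v - w))
  have h2 : act (M.mat x) (WithLp.toLp 2 (v - w)) = 0 := by
    rw [act, Matrix.toEuclideanCLM_toLp, Matrix.mulVec_sub, hvw, sub_self, WithLp.toLp_zero]
  rw [h2, norm_zero] at h1
  have h3 : WithLp.toLp 2 (v - w) = 0 := by
    rw [← norm_eq_zero]
    nlinarith [norm_nonneg (WithLp.toLp 2 (v - w))]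
  have h4 : v - w = 0 := (WithLp.toLp_eq_zero 2).1 h3
  exact sub_eq_zero.1 h4

theorem exists_norm_act_inv_le : ∃ C : ℝ, ∀ x v, ‖act ((M.mat x)⁻¹) v‖ ≤ C * ‖v‖ := by
  obtain ⟨c₀, c₁, hc₀, h⟩ := M.bounds
  refine ⟨c₀⁻¹, fun x v => ?_⟩
  have h1 := norm_act_ge (h x).1 (act ((M.mat x)⁻¹) v)
  have h2 : act (M.mat x) (act ((M.mat x)⁻¹) v) = v := by
    rw [← mul_apply_eq_comp, act, act, ← map_mul,
      Matrix.mul_nonsing_inv _ (M.isUnit_det x), map_one, one_apply_eq_self]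
  rw [h2] at h1
  rwa [inv_mul_eq_div, le_div_iff₀' hc₀]

theorem aemeasurable_inv (i j : Fin k) : AEMeasurable (fun x => (M.mat x)⁻¹ i j) volume := by
  have hM : AEMeasurable (fun x => (fun i j => M.mat x i j : Fin k → Fin k → ℂ)) volume :=
    aemeasurable_pi_lambda _ fun i => aemeasurable_pi_lambda _ fun j => M.aemeasurable i j
  have hof : Continuous fun B : Fin k → Fin k → ℂ => (Matrix.of B) := continuous_id
  have hdet : Measurable fun B : Fin k → Fin k → ℂ => (Matrix.of B).det :=
    hof.matrix_det.measurable
  have hadj : Measurable fun B : Fin k → Fin k → ℂ => (Matrix.of B).adjugate i j :=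
    (hof.matrix_adjugate.matrix_elem i j).measurable
  have := (hdet.inv.mul hadj).comp_aemeasurable hM
  refine this.congr (Eventually.of_forall fun x => ?_)
  simp only [Function.comp, Pi.mul_apply, Pi.inv_apply, Matrix.inv_def, Matrix.smul_apply,
    Ring.inverse_eq_inv', smul_eq_mul]
  rfl

end Medium

end Helpers

/-- Multiplication by `M(x)⁻¹`, an everywhere defined operator. -/
def Medium.mulInv {d k : ℕ} (M : Medium d k) : L2 d k →ₗ[ℂ] L2 d k :=
  (mulOp fun x => (M.mat x)⁻¹).toFun ∘ₗ
    LinearMap.codRestrict _ LinearMap.id (fun f =>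
      memLp_act M.aemeasurable_inv M.exists_norm_act_inv_le.choose_spec f)

/-- The Hilbert space `𝓗` attached to `M`: it consists of the same elements as `L₂(ℝᵈ; ℂᵏ)`, its
scalar product is `∫ ⟨M(x) f(x), g(x)⟩ dx`. -/
structure WeightedL2 {d k : ℕ} (M : Medium d k) where
  /-- an element of `L₂(ℝᵈ; ℂᵏ)`, considered as an element of `𝓗` -/
  ofL2 ::
  /-- the underlying element of `L₂(ℝᵈ; ℂᵏ)` -/
  elem : L2 d k

namespace WeightedL2

variable {d k : ℕ} (M : Medium d k)

/-- The identical mapping of `𝓗` onto `L₂(ℝᵈ; ℂᵏ)`, as a bijection. -/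
def equivL2 : WeightedL2 M ≃ L2 d k where
  toFun := elem
  invFun := ofL2
  left_inv _ := rfl
  right_inv _ := rfl

instance : AddCommGroup (WeightedL2 M) := (equivL2 M).addCommGroup

instance : Module ℂ (WeightedL2 M) := (equivL2 M).module ℂ

/-- The identical mapping of `𝓗` onto `L₂(ℝᵈ; ℂᵏ)`, as a linear isomorphism. -/
def toL2 : WeightedL2 M ≃ₗ[ℂ] L2 d k := (equivL2 M).linearEquiv ℂ

/-- The weighted scalar product `∫ ⟨M(x) f(x), g(x)⟩ dx`; in Mathlib's convention it is
conjugate-linear in the first argument. -/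
def weightedInner (f g : L2 d k) : ℂ := ∫ x, inner ℂ (f x) (act (M.mat x) (g x))

theorem integrable_weightedInner (f g : L2 d k) :
    Integrable (fun x => inner ℂ (f x) (act (M.mat x) (g x))) volume := by
  have h := memLp_act M.aemeasurable M.exists_norm_act_le.choose_spec g
  refine (L2.integrable_inner (𝕜 := ℂ) f (h.toLp _)).congr ?_
  filter_upwards [h.coeFn_toLp] with x hx
  rw [hx]

theorem re_weightedInner_self (f : L2 d k) : RCLike.re (weightedInner M f f) =
    ∫ x, RCLike.re (inner ℂ (f x) (act (M.mat x) (f x))) :=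
  (integral_re (integrable_weightedInner M f f)).symm

theorem re_inner_act_nonneg (x : Sp d) (v : EuclideanSpace ℂ (Fin k)) :
    0 ≤ RCLike.re (inner ℂ v (act (M.mat x) v)) := by
  obtain ⟨c₀, c₁, hc₀, h⟩ := M.bounds
  exact le_trans (by positivity) (inner_act_ge (h x).1 v)

/-- The weighted scalar product satisfies the axioms of a scalar product. -/
abbrev core : InnerProductSpace.Core ℂ (WeightedL2 M) where
  inner f g := weightedInner M (toL2 M f) (toL2 M g)
  conj_inner_symm f g := by
    rw [weightedInner, weightedInner, ← integral_conj]
    refine integral_congr_ae (Eventually.of_forall fun x => ?_)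
    simp only
    rw [inner_conj_symm, inner_act_symm (M.isHermitian x)]
  re_inner_nonneg f := by
    rw [re_weightedInner_self]
    exact integral_nonneg fun x => re_inner_act_nonneg M x _
  add_left f g h := by
    rw [weightedInner, weightedInner, weightedInner, ← integral_add
      (integrable_weightedInner M _ _) (integrable_weightedInner M _ _), map_add]
    refine integral_congr_ae ?_
    filter_upwards [Lp.coeFn_add (toL2 M f) (toL2 M g)] with x hx
    rw [hx, Pi.add_apply, inner_add_left]
  smul_left f g c := by
    rw [weightedInner, weightedInner, ← integral_const_mul, map_smul]
    refine integral_congr_ae ?_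
    filter_upwards [Lp.coeFn_smul c (toL2 M f)] with x hx
    rw [hx, Pi.smul_apply, inner_smul_left]
  definite f hf := by
    have h0 := re_weightedInner_self M (toL2 M f)
    rw [hf, map_zero, eq_comm, integral_eq_zero_iff_of_nonneg
      (fun x => re_inner_act_nonneg M x _) (integrable_weightedInner M _ _).re] at h0
    obtain ⟨c₀, c₁, hc₀, h⟩ := M.bounds
    have h1 : toL2 M f = 0 := by
      rw [Lp.eq_zero_iff_ae_eq_zero]
      filter_upwards [h0] with x hx
      have h2 := inner_act_ge (h x).1 (toL2 M f x)
      rw [hx, Pi.zero_apply] at h2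
      have h3 : ‖toL2 M f x‖ ^ 2 ≤ 0 := by
        by_contra! h4
        have := mul_pos hc₀ h4
        linarith
      rw [Pi.zero_apply, ← norm_eq_zero]
      exact pow_eq_zero_iff two_ne_zero |>.1 (le_antisymm h3 (by positivity))
    exact (toL2 M).map_eq_zero_iff.1 h1

instance : NormedAddCommGroup (WeightedL2 M) :=
  (core M).toNormedAddCommGroup

instance : InnerProductSpace ℂ (WeightedL2 M) :=
  InnerProductSpace.ofCore (core M).toCore

end WeightedL2

/-- The operator `H = M⁻¹ P(D)` in the space `𝓗`, with the domain `𝓓(H) = 𝓓(P(D))`. -/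
def mediumOp {d k : ℕ} (M : Medium d k) (A : Sp d → Matrix (Fin k) (Fin k) ℂ) :
    WeightedL2 M →ₗ.[ℂ] WeightedL2 M where
  domain := (pseudoDiffOp A).domain.comap (WeightedL2.toL2 M).toLinearMap
  toFun := (WeightedL2.toL2 M).symm.toLinearMap ∘ₗ M.mulInv ∘ₗ (pseudoDiffOp A).toFun ∘ₗ
    (WeightedL2.toL2 M).toLinearMap.restrict (fun _ hf => Submodule.mem_comap.1 hf)

end MediumScattering

end

/-!
By Weyl's criterion, a point `z` lies outside the essential spectrum of the self-adjoint operator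
`H` if and only if `H - z` has no singular sequence. Since `H - z = M⁻¹ (P(D) - z M)` and the norm
of `𝓗` is equivalent to that of `L₂`, this is a property of the pencil `P(D) - z M` in `L₂`, and it
is unchanged if `M` is replaced by `M₀` as soon as `M - M₀` is `P(D)`-relatively compact.

For relative compactness, let `f n` be weakly null with `P(D) f n` bounded. The Carleman condition
makes the high frequencies of `f n` uniformly small, while the low-frequency part is a Fourier
integral over a ball: it is bounded and tends to zero pointwise, hence in the mean square over every
bounded set. So `f n` tends to zero locally, and `M - M₀` is small far away.
-/

noncomputable section

namespace MediumScattering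

theorem tendsto_zero_of_forall_exists_norm_sub_le {E ι : Type*} [SeminormedAddCommGroup E]
    {f : ι → E} {l : Filter ι}
    (h : ∀ δ > 0, ∃ g : ι → E, Tendsto g l (𝓝 0) ∧ ∀ᶠ i in l, ‖f i - g i‖ ≤ δ) :
    Tendsto f l (𝓝 0) := by
  refine Metric.tendsto_nhds.2 fun ε hε => ?_
  obtain ⟨g, hg, hfg⟩ := h (ε / 2) (half_pos hε)
  filter_upwards [hfg, Metric.tendsto_nhds.1 hg (ε / 2) (half_pos hε)] with i hi hgi
  rw [dist_zero_right] at hgi ⊢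
  linarith [norm_le_norm_add_norm_sub' (f i) (g i)]

section WeakConvergence

variable {𝕜 E F ι : Type*} [RCLike 𝕜]

section Normed

variable [NormedAddCommGroup E] [NormedSpace 𝕜 E] [NormedAddCommGroup F] [NormedSpace 𝕜 F]
  {f g : ι → E} {l : Filter ι} {x y : E}

/-- Weak convergence of `f` to `x` along `l`, tested against the bounded linear functionals; `𝕜` is
explicit because it cannot be inferred from `f`. -/
def WeakTendsto (𝕜 : Type*) {E ι : Type*} [RCLike 𝕜] [NormedAddCommGroup E] [NormedSpace 𝕜 E]
    (f : ι → E) (l : Filter ι) (x : E) : Prop :=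
  ∀ φ : StrongDual 𝕜 E, Tendsto (fun i => φ (f i)) l (𝓝 (φ x))

theorem weakTendsto_of_tendsto (h : Tendsto f l (𝓝 x)) : WeakTendsto 𝕜 f l x :=
  fun φ => (φ.continuous.tendsto x).comp h

namespace WeakTendsto

theorem map (hf : WeakTendsto 𝕜 f l x) (S : E →L[𝕜] F) :
    WeakTendsto 𝕜 (fun i => S (f i)) l (S x) :=
  fun φ => hf (φ ∘L S)

theorem of_coe {V : Submodule 𝕜 E} {f : ι → V} {x : V}
    (hf : WeakTendsto 𝕜 (fun i => (f i : E)) l x) : WeakTendsto 𝕜 f l x := fun φ => by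
  obtain ⟨ψ, hψ, -⟩ := exists_extension_norm_eq V φ
  simpa only [hψ] using hf ψ

theorem add (hf : WeakTendsto 𝕜 f l x) (hg : WeakTendsto 𝕜 g l y) :
    WeakTendsto 𝕜 (fun i => f i + g i) l (x + y) := fun φ => by
  simpa only [map_add] using (hf φ).add (hg φ)

theorem sub (hf : WeakTendsto 𝕜 f l x) (hg : WeakTendsto 𝕜 g l y) :
    WeakTendsto 𝕜 (fun i => f i - g i) l (x - y) := fun φ => by
  simpa only [map_sub] using (hf φ).sub (hg φ)

theorem tendsto [FiniteDimensional 𝕜 E] (hf : WeakTendsto 𝕜 f l x) : Tendsto f l (𝓝 x) := by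
  let e := (Module.finBasis 𝕜 E).equivFunL
  have hcoord : Tendsto (fun i => e (f i)) l (𝓝 (e x)) := tendsto_pi_nhds.2 fun j =>
    hf (ContinuousLinearMap.proj (R := 𝕜) (φ := fun _ => 𝕜) j ∘L e.toContinuousLinearMap)
  simpa only [Function.comp_def, e.symm_apply_apply] using
    (e.symm.continuous.tendsto (e x)).comp hcoord

theorem exists_norm_le {f : ℕ → E} (hf : WeakTendsto 𝕜 f atTop x) : ∃ C, ∀ n, ‖f n‖ ≤ C := by
  obtain ⟨C, hC⟩ := banach_steinhaus (g := fun n => NormedSpace.inclusionInDoubleDual 𝕜 E (f n))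
    fun φ => by
      obtain ⟨C, hC⟩ := (hf φ).norm.bddAbove_range
      exact ⟨C, fun n => hC ⟨n, rfl⟩⟩
  refine ⟨C, fun n => ?_⟩
  rw [← (NormedSpace.inclusionInDoubleDualLi 𝕜 (E := E)).norm_map]
  exact hC n

end WeakTendsto

end Normed

section Hilbert

variable [NormedAddCommGroup E] [InnerProductSpace 𝕜 E] {f : ι → E} {l : Filter ι} {x : E}

theorem WeakTendsto.inner (hf : WeakTendsto 𝕜 f l x) (g : E) :
    Tendsto (fun i => inner 𝕜 g (f i)) l (𝓝 (inner 𝕜 g x)) := hf (innerSL 𝕜 g)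

variable [CompleteSpace E]

theorem weakTendsto_of_inner
    (h : ∀ g, Tendsto (fun i => inner 𝕜 g (f i)) l (𝓝 (inner 𝕜 g x))) : WeakTendsto 𝕜 f l x := by
  intro φ
  obtain ⟨g, rfl⟩ := (InnerProductSpace.toDual 𝕜 E).surjective φ
  simpa only [InnerProductSpace.toDual_apply_apply] using h g

theorem exists_subseq_weakTendsto_of_separable [TopologicalSpace.SeparableSpace E] {f : ℕ → E}
    {C : ℝ} (hf : ∀ n, ‖f n‖ ≤ C) : ∃ (x : E) (u : ℕ → ℕ), StrictMono u ∧
      WeakTendsto 𝕜 (f ∘ u) atTop x := by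
  obtain ⟨a, -, u, hu, ha⟩ := WeakDual.isSeqCompact_closedBall 𝕜 E 0 C
    (x := fun n => StrongDual.toWeakDual (InnerProductSpace.toDual 𝕜 E (f n)))
    (fun n => by simpa using hf n)
  obtain ⟨x, hx⟩ := (InnerProductSpace.toDual 𝕜 E).surjective (WeakDual.toStrongDual a)
  refine ⟨x, u, hu, weakTendsto_of_inner fun g => ?_⟩
  have hlim : Tendsto (fun n => inner 𝕜 (f (u n)) g) atTop (𝓝 (a g)) :=
    ((WeakDual.eval_continuous g).tendsto a).comp ha
  have hxg : a g = inner 𝕜 x g := by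
    rw [← InnerProductSpace.toDual_apply_apply (𝕜 := 𝕜), hx, WeakDual.toStrongDual_apply]
  rw [hxg] at hlim
  simpa only [Function.comp_def, inner_conj_symm] using
    (RCLike.continuous_conj.tendsto _).comp hlim

/-- One works in the closed linear span of the sequence, which is separable. -/
theorem exists_subseq_weakTendsto {f : ℕ → E} {C : ℝ} (hf : ∀ n, ‖f n‖ ≤ C) :
    ∃ (x : E) (u : ℕ → ℕ), StrictMono u ∧ WeakTendsto 𝕜 (f ∘ u) atTop x := by
  let V := (Submodule.span 𝕜 (Set.range f)).topologicalClosure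
  have hfV (n : ℕ) : f n ∈ V :=
    Submodule.le_topologicalClosure _ (Submodule.subset_span ⟨n, rfl⟩)
  have : TopologicalSpace.SeparableSpace V :=
    ((Set.countable_range f).isSeparable.span (R := 𝕜)).closure.separableSpace
  have : CompleteSpace V := (Submodule.isClosed_topologicalClosure _).completeSpace_coe
  obtain ⟨x, u, hu, hx⟩ :=
    exists_subseq_weakTendsto_of_separable (𝕜 := 𝕜) (f := fun n => (⟨f n, hfV n⟩ : V)) hf
  exact ⟨x, u, hu, hx.map V.subtypeL⟩

end Hilbert

end WeakConvergence

section SelfAdjoint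

section RCLike

variable {𝕜 E ι : Type*} [RCLike 𝕜] [NormedAddCommGroup E] [InnerProductSpace 𝕜 E]
  [CompleteSpace E] {T : E →ₗ.[𝕜] E}

theorem isSelfAdjoint_iff_isFormalAdjoint_and_forall_exists : IsSelfAdjoint T ↔
    T.IsFormalAdjoint T ∧
      ∀ g h : E, (∀ f : T.domain, inner 𝕜 (T f) g = inner 𝕜 (f : E) h) →
        ∃ hg : g ∈ T.domain, T ⟨g, hg⟩ = h := by
  rw [LinearPMap.isSelfAdjoint_def]
  constructor
  · intro hT
    have hdense : Dense (T.domain : Set E) := (LinearPMap.isSelfAdjoint_def.2 hT).dense_domain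
    refine ⟨by simpa only [hT] using LinearPMap.adjoint_isFormalAdjoint hdense, fun g h hgh => ?_⟩
    have hhg (f : T.domain) : inner 𝕜 h (f : E) = inner 𝕜 g (T f) := by
      rw [← inner_conj_symm, ← hgh f, inner_conj_symm]
    have hg := LinearPMap.mem_adjoint_domain_of_exists g ⟨h, hhg⟩
    have happly := LinearPMap.adjoint_apply_eq hdense ⟨g, hg⟩ hhg
    revert hg happly
    rw [hT]
    exact fun hg happly => ⟨hg, happly⟩
  · rintro ⟨hsymm, hmax⟩
    have hdense : Dense (T.domain : Set E) := by
      rw [Submodule.dense_iff_topologicalClosure_eq_top, Submodule.topologicalClosure_eq_top_iff,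
        Submodule.eq_bot_iff]
      intro h hh
      obtain ⟨h0, h1⟩ := hmax 0 h fun f => by rw [inner_zero_right, hh f f.2]
      rw [← h1]
      exact T.map_zero
    have hadj := LinearPMap.adjoint_isFormalAdjoint hdense
    have hle : T.adjoint ≤ T := by
      refine ⟨fun g hg => (hmax g (T.adjoint ⟨g, hg⟩) fun f => hadj.symm f ⟨g, hg⟩).1,
        fun g f hgf => ?_⟩
      obtain ⟨_, hval⟩ := hmax g (T.adjoint g) fun f => hadj.symm f g
      simpa only [hgf] using hval.symm
    exact le_antisymm hle (hsymm.le_adjoint hdense)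

theorem exists_apply_eq_of_weakTendsto (hT : IsSelfAdjoint T) {l : Filter ι} [l.NeBot]
    {f : ι → T.domain} {x y : E} (hx : WeakTendsto 𝕜 (fun i => (f i : E)) l x)
    (hy : WeakTendsto 𝕜 (fun i => T (f i)) l y) : ∃ h : x ∈ T.domain, T ⟨x, h⟩ = y := by
  obtain ⟨hsymm, hmax⟩ := isSelfAdjoint_iff_isFormalAdjoint_and_forall_exists.1 hT
  refine hmax x y fun g => tendsto_nhds_unique (hx.inner (T g)) ?_
  simpa only [hsymm g] using hy.inner (g : E)

end RCLike

variable {E : Type*} [NormedAddCommGroup E] [InnerProductSpace ℂ E]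

/-- The linear pencil `T - z B` on the domain of `T`. -/
def pencil (T : E →ₗ.[ℂ] E) (B : E →L[ℂ] E) (z : ℂ) : T.domain →ₗ[ℂ] E :=
  T.toFun - z • B.toLinearMap ∘ₗ T.domain.subtype

theorem pencil_apply (T : E →ₗ.[ℂ] E) (B : E →L[ℂ] E) (z : ℂ) (f : T.domain) :
    pencil T B z f = T f - z • B f := rfl

theorem pencil_one_apply (T : E →ₗ.[ℂ] E) (z : ℂ) (f : T.domain) :
    pencil T 1 z f = T f - z • (f : E) := rfl

variable {T : E →ₗ.[ℂ] E} {z : ℂ} {c : ℝ}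

theorem mem_eigenspace_iff {x : E} :
    x ∈ eigenspace T z ↔ ∃ f : T.domain, (f : E) = x ∧ pencil T 1 z f = 0 := by
  constructor
  · rintro ⟨hx, hTx⟩
    exact ⟨⟨x, hx⟩, rfl, sub_eq_zero.2 hTx⟩
  · rintro ⟨f, rfl, hf⟩
    exact ⟨f.2, sub_eq_zero.1 hf⟩

theorem eigenspace_eq_bot_of_mul_norm_le (hc : 0 < c)
    (h : ∀ f : T.domain, c * ‖(f : E)‖ ≤ ‖pencil T 1 z f‖) : eigenspace T z = ⊥ := by
  rw [Submodule.eq_bot_iff]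
  intro x hx
  obtain ⟨f, rfl, hf⟩ := mem_eigenspace_iff.1 hx
  have hfc := h f
  rw [hf, norm_zero] at hfc
  exact norm_le_zero_iff.1 (nonpos_of_mul_nonpos_right hfc hc)

theorem isRegularPoint_of_surjective (hc : 0 < c)
    (h : ∀ f : T.domain, c * ‖(f : E)‖ ≤ ‖pencil T 1 z f‖)
    (hsurj : Function.Surjective (pencil T 1 z)) : IsRegularPoint T z := by
  have hinj : Function.Injective (pencil T 1 z) := by
    refine (injective_iff_map_eq_zero _).2 fun f hf => Subtype.ext ?_
    exact (Submodule.eq_bot_iff _).1 (eigenspace_eq_bot_of_mul_norm_le hc h) f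
      (mem_eigenspace_iff.2 ⟨f, rfl, hf⟩)
  let e := LinearEquiv.ofBijective (pencil T 1 z) ⟨hinj, hsurj⟩
  have he (y : E) : pencil T 1 z (e.symm y) = y := e.apply_symm_apply y
  refine ⟨(T.domain.subtype ∘ₗ e.symm.toLinearMap).mkContinuous c⁻¹ fun y => ?_,
    fun y => ⟨(e.symm y).2, he y⟩, fun f => congrArg Subtype.val (e.symm_apply_apply f)⟩
  rw [inv_mul_eq_div, le_div_iff₀' hc]
  exact (h (e.symm y)).trans_eq (congrArg norm (he y))

theorem abs_im_mul_norm_le (hT : T.IsFormalAdjoint T) (z : ℂ) (f : T.domain) :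
    |z.im| * ‖(f : E)‖ ≤ ‖pencil T 1 z f‖ := by
  have hreal : (inner ℂ (f : E) (T f)).im = 0 := by
    rw [← Complex.conj_eq_iff_im, inner_conj_symm, hT]
  have hself : inner ℂ (f : E) (f : E) = ((‖(f : E)‖ ^ 2 : ℝ) : ℂ) := by
    rw [inner_self_eq_norm_sq_to_K]
    norm_cast
  have him : (inner ℂ (f : E) (pencil T 1 z f)).im = -(z.im * ‖(f : E)‖ ^ 2) := by
    rw [pencil_one_apply, inner_sub_right, inner_smul_right, hself, Complex.sub_im, hreal,
      zero_sub, Complex.im_mul_ofReal]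
  have hle : |z.im| * ‖(f : E)‖ ^ 2 ≤ ‖(f : E)‖ * ‖pencil T 1 z f‖ := by
    calc |z.im| * ‖(f : E)‖ ^ 2 = |(inner ℂ (f : E) (pencil T 1 z f)).im| := by
          rw [him, abs_neg, abs_mul, abs_of_nonneg (sq_nonneg ‖(f : E)‖)]
      _ ≤ _ := (Complex.abs_im_le_norm _).trans (norm_inner_le_norm _ _)
  rcases (norm_nonneg (f : E)).eq_or_lt' with hf | hf
  · rw [hf, mul_zero]
    exact norm_nonneg _
  · nlinarith

theorem norm_sub_mul_norm_inner_le (hT : T.IsFormalAdjoint T) (him : z.im = 0) {g : E}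
    (hg : g ∈ eigenspace T z) (w : ℂ) (f : T.domain) :
    ‖w - z‖ * ‖inner ℂ g (f : E)‖ ≤ ‖g‖ * ‖pencil T 1 w f‖ := by
  obtain ⟨hgT, hTg⟩ := hg
  have hinner : inner ℂ g (pencil T 1 w f) = (z - w) * inner ℂ g (f : E) := by
    rw [pencil_one_apply, inner_sub_right, inner_smul_right, ← hT ⟨g, hgT⟩ f, hTg,
      inner_smul_left, Complex.conj_eq_iff_im.2 him, sub_mul]
  rw [norm_sub_rev, ← norm_mul, ← hinner]
  exact norm_inner_le_norm _ _

variable [CompleteSpace E]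

theorem isClosed_range_pencil (hT : IsSelfAdjoint T) (hc : 0 < c)
    (h : ∀ f : T.domain, c * ‖(f : E)‖ ≤ ‖pencil T 1 z f‖) :
    IsClosed (LinearMap.range (pencil T 1 z) : Set E) := by
  refine IsSeqClosed.isClosed fun u y hu hy => ?_
  choose f hf using hu
  have hcauchy : CauchySeq (fun n => (f n : E)) := by
    rw [cauchySeq_iff_tendsto_dist_atTop_0]
    have hdist := (cauchySeq_iff_tendsto_dist_atTop_0.1 hy.cauchySeq).const_mul c⁻¹
    rw [mul_zero] at hdist
    refine squeeze_zero (fun _ => dist_nonneg) (fun p => ?_) hdist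
    rw [inv_mul_eq_div, le_div_iff₀' hc, dist_eq_norm, dist_eq_norm, ← hf, ← hf, ← map_sub]
    exact h (f p.1 - f p.2)
  obtain ⟨x, hx⟩ := cauchySeq_tendsto_of_complete hcauchy
  have hTf : Tendsto (fun n => T (f n)) atTop (𝓝 (y + z • x)) :=
    (hy.add (hx.const_smul z)).congr fun n => by rw [← hf, pencil_one_apply, sub_add_cancel]
  obtain ⟨hxT, hTx⟩ := exists_apply_eq_of_weakTendsto hT (weakTendsto_of_tendsto (𝕜 := ℂ) hx)
    (weakTendsto_of_tendsto hTf)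
  exact ⟨⟨x, hxT⟩, by rw [pencil_one_apply, hTx, add_sub_cancel_right]⟩

theorem orthogonal_range_pencil_le (hT : IsSelfAdjoint T) (z : ℂ) :
    (LinearMap.range (pencil T 1 z))ᗮ ≤ eigenspace T (starRingEnd ℂ z) := by
  intro g hg
  refine (isSelfAdjoint_iff_isFormalAdjoint_and_forall_exists.1 hT).2 g _ fun f => ?_
  have horth : inner ℂ (pencil T 1 z f) g = 0 := hg _ ⟨f, rfl⟩
  rw [pencil_one_apply, inner_sub_left, inner_smul_left, sub_eq_zero] at horth
  rw [horth, inner_smul_right]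

theorem isRegularPoint_of_mul_norm_le (hT : IsSelfAdjoint T) (hc : 0 < c)
    (h : ∀ f : T.domain, c * ‖(f : E)‖ ≤ ‖pencil T 1 z f‖) : IsRegularPoint T z := by
  have hsymm := (isSelfAdjoint_iff_isFormalAdjoint_and_forall_exists.1 hT).1
  have hconj : eigenspace T (starRingEnd ℂ z) = ⊥ := by
    by_cases hz : z.im = 0
    · rw [Complex.conj_eq_iff_im.2 hz]
      exact eigenspace_eq_bot_of_mul_norm_le hc h
    · refine eigenspace_eq_bot_of_mul_norm_le (abs_pos.2 ?_) (abs_im_mul_norm_le hsymm _)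
      rwa [Complex.conj_im, neg_ne_zero]
  have := (isClosed_range_pencil hT hc h).completeSpace_coe
  refine isRegularPoint_of_surjective hc h (LinearMap.range_eq_top.1 ?_)
  rw [← Submodule.orthogonal_eq_bot_iff, eq_bot_iff, ← hconj]
  exact orthogonal_range_pencil_le hT z

theorem im_eq_zero_of_mem_opSpectrum (hT : IsSelfAdjoint T) (hz : z ∈ opSpectrum T) :
    z.im = 0 := by
  by_contra him
  exact hz (isRegularPoint_of_mul_norm_le hT (abs_pos.2 him)
    (abs_im_mul_norm_le (isSelfAdjoint_iff_isFormalAdjoint_and_forall_exists.1 hT).1 z))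

theorem exists_norm_eq_one_norm_pencil_le (hT : IsSelfAdjoint T) (hz : z ∈ opSpectrum T)
    (hc : 0 < c) : ∃ f : T.domain, ‖(f : E)‖ = 1 ∧ ‖pencil T 1 z f‖ ≤ c := by
  by_contra! h
  refine hz (isRegularPoint_of_mul_norm_le hT hc fun f => ?_)
  rcases eq_or_ne (f : E) 0 with hf | hf
  · rw [hf, norm_zero, mul_zero]
    exact norm_nonneg _
  · have hlt := h ((‖(f : E)‖⁻¹ : ℂ) • f) (norm_smul_inv_norm hf)
    rw [map_smul, norm_smul, norm_inv, Complex.norm_real, norm_norm, inv_mul_eq_div,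
      lt_div_iff₀ (norm_pos_iff.2 hf)] at hlt
    exact hlt.le

end SelfAdjoint

section Weyl

/-- Weyl's condition: `S` has no singular sequence, that is, a weakly null sequence `f` with
`S (f n) → 0` converges to zero in norm. -/
def NoSingularSequence {E F : Type*} [NormedAddCommGroup E] [NormedSpace ℂ E]
    [NormedAddCommGroup F] [NormedSpace ℂ F] {D : Submodule ℂ E} (S : D →ₗ[ℂ] F) : Prop :=
  ∀ f : ℕ → D, WeakTendsto ℂ (fun n => (f n : E)) atTop 0 →
    Tendsto (fun n => S (f n)) atTop (𝓝 0) → Tendsto (fun n => (f n : E)) atTop (𝓝 0)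

section Resolvent

variable {E : Type*} [NormedAddCommGroup E] [NormedSpace ℂ E] {T : E →ₗ.[ℂ] E} {w w' z : ℂ}
  {R R' : E →L[ℂ] E}

/-- `R` is the resolvent `(T - z)⁻¹`; the two conditions are those of `IsRegularPoint`. -/
structure IsResolvent (T : E →ₗ.[ℂ] E) (z : ℂ) (R : E →L[ℂ] E) : Prop where
  right_inverse : ∀ y : E, ∃ h : R y ∈ T.domain, T ⟨R y, h⟩ - z • R y = y
  left_inverse : ∀ x : T.domain, R (T x - z • (x : E)) = x

theorem isRegularPoint_iff_exists_isResolvent :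
    IsRegularPoint T z ↔ ∃ R, IsResolvent T z R :=
  exists_congr fun _ => ⟨fun h => ⟨h.1, h.2⟩, fun h => ⟨h.1, h.2⟩⟩

namespace IsResolvent

theorem sub_eq_smul_mul (hR : IsResolvent T w R) (hR' : IsResolvent T w' R') :
    R' - R = (w' - w) • (R * R') := by
  ext y
  obtain ⟨hy, hTy⟩ := hR'.right_inverse y
  have hshift : T ⟨R' y, hy⟩ - w • R' y = y + (w' - w) • R' y := by
    rw [sub_smul, sub_eq_iff_eq_add.1 hTy]
    abel
  have hleft := hR.left_inverse ⟨R' y, hy⟩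
  rw [hshift, map_add, map_smul] at hleft
  exact (eq_sub_of_add_eq' hleft).symm

theorem notMem_spectrum (hR : IsResolvent T w R) {t : ℂ} (ht : t ≠ 0)
    (hreg : IsRegularPoint T (w + t⁻¹)) : t ∉ spectrum ℂ R := by
  obtain ⟨R', hR'⟩ := isRegularPoint_iff_exists_isResolvent.1 hreg
  have hRR' : R * R' = t • (R' - R) := by
    rw [hR.sub_eq_smul_mul hR', add_sub_cancel_left, smul_inv_smul₀ ht]
  have hR'R : R' * R = t • (R' - R) := by
    rw [← neg_sub R, hR'.sub_eq_smul_mul hR, sub_add_cancel_left, neg_smul, neg_neg,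
      smul_inv_smul₀ ht]
  refine spectrum.notMem_iff.2 (isUnit_iff_exists.2 ⟨t⁻¹ • (1 + t⁻¹ • R'), ?_, ?_⟩) <;>
  · simp only [Algebra.algebraMap_eq_smul_one, sub_mul, mul_sub, mul_add, add_mul, smul_mul_assoc,
      mul_smul_comm, one_mul, mul_one, hRR', hR'R, smul_sub, smul_add, smul_smul]
    match_scalars <;> field_simp <;> ring

theorem mem_eigenspace (hR : IsResolvent T w R) {μ : ℂ} (hμ : μ ≠ 0) {x : E} (hx : R x = μ • x) :
    x ∈ eigenspace T (w + μ⁻¹) := by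
  have hRx : R x ∈ eigenspace T (w + μ⁻¹) := by
    obtain ⟨h, hT⟩ := hR.right_inverse x
    refine ⟨h, ?_⟩
    rw [sub_eq_iff_eq_add.1 hT, add_smul, add_comm, hx, inv_smul_smul₀ hμ]
  rw [← inv_smul_smul₀ hμ x, ← hx]
  exact Submodule.smul_mem _ _ hRx

end IsResolvent

end Resolvent

/-- A generalized inverse of `a - μ` is `(t - μ)⁻¹` applied to `a`; with the convention `0⁻¹ = 0`
this function is continuous on the spectrum because `μ` is not an accumulation point of it. -/
theorem exists_mul_mul_sub_eq_sub {A : Type*} [CStarAlgebra A] {a : A} [IsStarNormal a] {μ : ℂ}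
    (hμ : ∀ᶠ t in 𝓝[≠] μ, t ∉ spectrum ℂ a) :
    ∃ g : A, (a - algebraMap ℂ A μ) * g * (a - algebraMap ℂ A μ) = a - algebraMap ℂ A μ := by
  have hcont : ContinuousOn (fun t : ℂ => (t - μ)⁻¹) (spectrum ℂ a) := by
    intro t _
    rcases eq_or_ne t μ with rfl | htμ
    · have hisolated : 𝓝[spectrum ℂ a] t ≤ pure t := by
        rw [eventually_nhdsWithin_iff] at hμ
        rw [nhdsWithin, le_pure_iff, mem_inf_principal]
        filter_upwards [hμ] with s hs hsa
        exact not_not.1 fun hst => hs hst hsa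
      exact (tendsto_pure_nhds _ _).mono_left hisolated
    · exact ((continuousAt_id.sub continuousAt_const).inv₀ (sub_ne_zero.2 htμ)).continuousWithinAt
  have hsub : cfc (fun t : ℂ => t - μ) a = a - algebraMap ℂ A μ := by
    rw [cfc_sub _ _ a, cfc_id' ℂ a, cfc_const μ a]
  refine ⟨cfc (fun t : ℂ => (t - μ)⁻¹) a, ?_⟩
  rw [← hsub, ← cfc_mul _ _ a, ← cfc_mul _ _ a]
  exact cfc_congr fun t _ => mul_inv_mul_cancel (t - μ)

variable {E : Type*} [NormedAddCommGroup E] [InnerProductSpace ℂ E] {T : E →ₗ.[ℂ] E} {z : ℂ}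

theorem noSingularSequence_of_sub_mem {F : Type*} [NormedAddCommGroup F] [NormedSpace ℂ F]
    {D : Submodule ℂ E} {S : D →ₗ[ℂ] F} {V : Submodule ℂ E} [FiniteDimensional ℂ V] {G : F →L[ℂ] E}
    (hG : ∀ f : D, (f : E) - G (S f) ∈ V) : NoSingularSequence S := by
  intro f hweak hlim
  have hGS : Tendsto (fun n => G (S (f n))) atTop (𝓝 0) := by
    simpa only [map_zero, Function.comp_def] using (G.continuous.tendsto 0).comp hlim
  have hV : WeakTendsto ℂ (fun n => (⟨_, hG (f n)⟩ : V)) atTop 0 := by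
    refine WeakTendsto.of_coe ?_
    simpa only [Submodule.coe_zero, sub_zero] using hweak.sub (weakTendsto_of_tendsto hGS)
  have hV_norm := (continuous_subtype_val.tendsto (0 : V)).comp hV.tendsto
  simpa only [Function.comp_def, sub_add_cancel, Submodule.coe_zero, add_zero] using
    hV_norm.add hGS

theorem noSingularSequence_of_isRegularPoint (hz : IsRegularPoint T z) :
    NoSingularSequence (pencil T 1 z) := by
  obtain ⟨R, -, hR⟩ := hz
  exact noSingularSequence_of_sub_mem (V := ⊥) (G := R) fun f => sub_eq_zero.2 (hR f).symm

theorem eventually_notMem_spectrum_resolvent {w : ℂ} {R : E →L[ℂ] E} (hR : IsResolvent T w R)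
    (hwz : z ≠ w) (hz : ∀ᶠ ζ in 𝓝[≠] z, ζ ∉ opSpectrum T) :
    ∀ᶠ t in 𝓝[≠] (z - w)⁻¹, t ∉ spectrum ℂ R := by
  have hμ : (z - w)⁻¹ ≠ 0 := inv_ne_zero (sub_ne_zero.2 hwz)
  have hlim : Tendsto (fun t : ℂ => w + t⁻¹) (𝓝[≠] (z - w)⁻¹) (𝓝[≠] z) := by
    have hcont : ContinuousAt (fun t : ℂ => w + t⁻¹) (z - w)⁻¹ :=
      continuousAt_const.add (continuousAt_inv₀ hμ)
    have hval : w + ((z - w)⁻¹)⁻¹ = z := by rw [inv_inv, add_sub_cancel]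
    have hinj : Function.Injective fun t : ℂ => w + t⁻¹ :=
      (add_right_injective w).comp inv_injective
    simpa only [hval] using hcont.continuousWithinAt.tendsto_nhdsWithin
      (s := {(z - w)⁻¹}ᶜ) (t := {w + ((z - w)⁻¹)⁻¹}ᶜ) fun t ht => hinj.ne ht
  filter_upwards [hlim.eventually hz, eventually_nhdsWithin_of_eventually_nhds
    (eventually_ne_nhds hμ)] with t ht ht0
  exact hR.notMem_spectrum ht0 (not_not.1 ht)

theorem exists_real_isRegularPoint (him : z.im = 0) (hz : ∀ᶠ w in 𝓝[≠] z, w ∉ opSpectrum T) :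
    ∃ w : ℝ, z ≠ w ∧ IsRegularPoint T w := by
  have hlim : Tendsto (fun r : ℝ => (r : ℂ)) (𝓝[≠] z.re) (𝓝[≠] z) := by
    have hre : (z.re : ℂ) = z := Complex.ext rfl him.symm
    have hcont := Complex.continuous_ofReal.continuousWithinAt (s := {z.re}ᶜ) (x := z.re)
    simpa only [hre] using hcont.tendsto_nhdsWithin (t := {(z.re : ℂ)}ᶜ)
      fun r hr => Complex.ofReal_injective.ne hr
  obtain ⟨w, hw, hwz⟩ := ((hlim.eventually hz).and self_mem_nhdsWithin).exists
  exact ⟨w, fun h => hwz (by rw [h, Complex.ofReal_re]; rfl), not_not.1 hw⟩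

variable [CompleteSpace E]

theorem IsResolvent.isSelfAdjoint (hT : T.IsFormalAdjoint T) {w : ℝ} {R : E →L[ℂ] E}
    (hR : IsResolvent T w R) : IsSelfAdjoint R := by
  rw [ContinuousLinearMap.isSelfAdjoint_iff_isSymmetric]
  intro x y
  obtain ⟨hx, hTx⟩ := hR.right_inverse x
  obtain ⟨hy, hTy⟩ := hR.right_inverse y
  calc inner ℂ (R x) y = inner ℂ (R x) (T ⟨R y, hy⟩ - (w : ℂ) • R y) := by rw [hTy]
    _ = inner ℂ (T ⟨R x, hx⟩ - (w : ℂ) • R x) (R y) := by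
      rw [inner_sub_left, inner_sub_right, inner_smul_left, inner_smul_right, Complex.conj_ofReal,
        hT ⟨R x, hx⟩ ⟨R y, hy⟩]
    _ = inner ℂ x (R y) := by rw [hTx]

theorem noSingularSequence_of_isIsolatedFiniteEigenvalue (hT : T.IsFormalAdjoint T)
    (him : z.im = 0) (hz : IsIsolatedFiniteEigenvalue T z) :
    NoSingularSequence (pencil T 1 z) := by
  obtain ⟨-, hfin, hisolated⟩ := hz
  obtain ⟨w, hwz, hw⟩ := exists_real_isRegularPoint him hisolated
  obtain ⟨R, hR⟩ := isRegularPoint_iff_exists_isResolvent.1 hw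
  have := (hR.isSelfAdjoint hT).isStarNormal
  obtain ⟨G, hG⟩ := exists_mul_mul_sub_eq_sub (A := E →L[ℂ] E)
    (eventually_notMem_spectrum_resolvent hR hwz hisolated)
  have hμ : (z - w)⁻¹ ≠ 0 := inv_ne_zero (sub_ne_zero.2 hwz)
  set Rμ : E →L[ℂ] E := R - algebraMap ℂ _ (z - w)⁻¹ with hRμ
  have hRμ_apply (f : T.domain) : Rμ f = (-(z - w)⁻¹ • R) (pencil T 1 z f) := by
    have hsplit : pencil T 1 z f = (T f - (w : ℂ) • (f : E)) - (z - w) • (f : E) := by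
      rw [pencil_one_apply, sub_smul, sub_sub, add_sub_cancel]
    rw [smul_apply, hsplit, map_sub, hR.left_inverse, map_smul, smul_sub, neg_smul, neg_smul,
      inv_smul_smul₀ (sub_ne_zero.2 hwz), hRμ, Algebra.algebraMap_eq_smul_one, sub_apply,
      smul_apply, one_apply_eq_self, sub_neg_eq_add, neg_add_eq_sub]
  refine noSingularSequence_of_sub_mem (V := eigenspace T z) (G := G ∘L (-(z - w)⁻¹ • R))
    fun f => ?_
  have hker : Rμ (f - G (Rμ f)) = 0 := by
    rw [map_sub, sub_eq_zero]
    exact (congrArg (fun S : E →L[ℂ] E => S f) hG).symm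
  have hmem := hR.mem_eigenspace hμ (x := f - G (Rμ f)) (sub_eq_zero.1 hker)
  rwa [inv_inv, add_sub_cancel, hRμ_apply] at hmem

theorem exists_subseq_tendsto_mem_eigenspace (hT : IsSelfAdjoint T)
    (hS : NoSingularSequence (pencil T 1 z)) {f : ℕ → T.domain} {C : ℝ}
    (hf : ∀ n, ‖(f n : E)‖ ≤ C) (hlim : Tendsto (fun n => pencil T 1 z (f n)) atTop (𝓝 0)) :
    ∃ x ∈ eigenspace T z, ∃ u : ℕ → ℕ, StrictMono u ∧
      Tendsto (fun n => (f (u n) : E)) atTop (𝓝 x) := by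
  obtain ⟨x, u, hu, hweak⟩ := exists_subseq_weakTendsto (𝕜 := ℂ) hf
  have hlim_u := hlim.comp hu.tendsto_atTop
  have hx : x ∈ eigenspace T z := by
    refine exists_apply_eq_of_weakTendsto hT (f := f ∘ u) hweak ?_
    simpa [pencil_one_apply] using
      (weakTendsto_of_tendsto (𝕜 := ℂ) hlim_u).add (hweak.map (z • ContinuousLinearMap.id ℂ E))
  obtain ⟨g, rfl, hg⟩ := mem_eigenspace_iff.1 hx
  refine ⟨g, hx, u, hu, ?_⟩
  have hdiff : Tendsto (fun n => ((f (u n) - g : T.domain) : E)) atTop (𝓝 0) := by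
    refine hS _ ?_ (by simpa only [map_sub, hg, sub_zero, Function.comp_def] using hlim_u)
    simpa only [Submodule.coe_sub, sub_self, Function.comp_apply] using
      hweak.sub (weakTendsto_of_tendsto (tendsto_const_nhds (x := (g : E))))
  simpa using hdiff.add_const (g : E)

theorem finiteDimensional_eigenspace (hT : IsSelfAdjoint T)
    (hS : NoSingularSequence (pencil T 1 z)) : FiniteDimensional ℂ (eigenspace T z) := by
  refine FiniteDimensional.of_isCompact_closedBall₀ ℂ one_pos (IsSeqCompact.isCompact ?_)
  intro v hv
  choose f hf hker using fun n => mem_eigenspace_iff.1 (v n).2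
  obtain ⟨x, hx, u, hu, hlim⟩ := exists_subseq_tendsto_mem_eigenspace hT hS (f := f) (C := 1)
    (fun n => by simpa [hf] using hv n) (by simp only [hker, tendsto_const_nhds])
  have hlim' : Tendsto (v ∘ u) atTop (𝓝 (⟨x, hx⟩ : eigenspace T z)) :=
    tendsto_subtype_rng.2 (by simpa only [hf, Function.comp_apply] using hlim)
  exact ⟨_, Metric.isClosed_closedBall.mem_of_tendsto hlim' (.of_forall fun n => hv (u n)),
    u, hu, hlim'⟩

theorem eigenspace_ne_bot_of_mem_opSpectrum (hT : IsSelfAdjoint T)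
    (hS : NoSingularSequence (pencil T 1 z)) (hz : z ∈ opSpectrum T) : eigenspace T z ≠ ⊥ := by
  choose f hf hfz using fun n : ℕ =>
    exists_norm_eq_one_norm_pencil_le hT hz (Nat.one_div_pos_of_nat (n := n))
  obtain ⟨x, hx, u, -, hlim⟩ := exists_subseq_tendsto_mem_eigenspace hT hS
    (fun n => (hf n).le) (squeeze_zero_norm hfz tendsto_one_div_add_atTop_nhds_zero_nat)
  have hx1 : ‖x‖ = 1 := tendsto_nhds_unique hlim.norm (by simp only [hf, tendsto_const_nhds])
  intro hbot
  rw [(Submodule.eq_bot_iff _).1 hbot x hx, norm_zero] at hx1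
  exact zero_ne_one hx1

/-- Approximate eigenvectors at spectral points `w n → z` would converge to an eigenvector at `z`,
which is impossible since they are asymptotically orthogonal to the eigenspace at `z`. -/
theorem eventually_notMem_opSpectrum (hT : IsSelfAdjoint T)
    (hS : NoSingularSequence (pencil T 1 z)) (him : z.im = 0) :
    ∀ᶠ w in 𝓝[≠] z, w ∉ opSpectrum T := by
  by_contra hfreq
  obtain ⟨w, hwz, hw⟩ := exists_seq_forall_of_frequently
    ((not_eventually.1 hfreq).and_eventually eventually_mem_nhdsWithin)
  have hwz0 : Tendsto (fun n => w n - z) atTop (𝓝 0) :=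
    tendsto_sub_nhds_zero_iff.2 (hwz.mono_right nhdsWithin_le_nhds)
  have hpos (n : ℕ) : 0 < ‖w n - z‖ := norm_pos_iff.2 (sub_ne_zero.2 (hw n).2)
  choose f hf hfw using fun n : ℕ => exists_norm_eq_one_norm_pencil_le hT (not_not.1 (hw n).1)
    (mul_pos (hpos n) (Nat.one_div_pos_of_nat (n := n)))
  have hlim : Tendsto (fun n => pencil T 1 z (f n)) atTop (𝓝 0) := by
    have hfw0 : Tendsto (fun n => pencil T 1 (w n) (f n)) atTop (𝓝 0) := squeeze_zero_norm hfw
      (by simpa using hwz0.norm.mul tendsto_one_div_add_atTop_nhds_zero_nat)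
    have hwf0 : Tendsto (fun n => (w n - z) • (f n : E)) atTop (𝓝 0) :=
      squeeze_zero_norm (fun n => by rw [norm_smul, hf, mul_one]) (by simpa using hwz0.norm)
    have hsum := hfw0.add hwf0
    rw [add_zero] at hsum
    refine hsum.congr fun n => ?_
    rw [pencil_one_apply, pencil_one_apply, sub_smul, sub_add_sub_cancel]
  obtain ⟨x, hx, u, hu, hfx⟩ := exists_subseq_tendsto_mem_eigenspace hT hS (fun n => (hf n).le) hlim
  have horth (n : ℕ) : ‖inner ℂ x (f n : E)‖ ≤ ‖x‖ * (1 / (n + 1)) := by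
    have hle := (norm_sub_mul_norm_inner_le
      (isSelfAdjoint_iff_isFormalAdjoint_and_forall_exists.1 hT).1 him hx (w n) (f n)).trans
      (mul_le_mul_of_nonneg_left (hfw n) (norm_nonneg x))
    rw [mul_left_comm] at hle
    exact le_of_mul_le_mul_left hle (hpos n)
  have hzero : Tendsto (fun n => inner ℂ x (f n : E)) atTop (𝓝 0) :=
    squeeze_zero_norm horth
      (by simpa using tendsto_one_div_add_atTop_nhds_zero_nat.const_mul ‖x‖)
  have hxx := tendsto_nhds_unique (((innerSL ℂ x).continuous.tendsto _).comp hfx)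
    (hzero.comp hu.tendsto_atTop)
  have hx1 : ‖x‖ = 1 := tendsto_nhds_unique hfx.norm (by simp only [hf, tendsto_const_nhds])
  rw [innerSL_apply_apply, inner_self_eq_zero] at hxx
  rw [hxx, norm_zero] at hx1
  exact zero_ne_one hx1

theorem notMem_essentialSpectrum_iff (hT : IsSelfAdjoint T) :
    z ∉ essentialSpectrum T ↔ NoSingularSequence (pencil T 1 z) := by
  constructor
  · intro hz
    by_cases hspec : z ∈ opSpectrum T
    · exact noSingularSequence_of_isIsolatedFiniteEigenvalue
        (isSelfAdjoint_iff_isFormalAdjoint_and_forall_exists.1 hT).1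
        (im_eq_zero_of_mem_opSpectrum hT hspec) (not_not.1 fun h => hz ⟨hspec, h⟩)
    · exact noSingularSequence_of_isRegularPoint (not_not.1 hspec)
  · rintro hS ⟨hspec, hnot⟩
    exact hnot ⟨eigenspace_ne_bot_of_mem_opSpectrum hT hS hspec, finiteDimensional_eigenspace hT hS,
      eventually_notMem_opSpectrum hT hS (im_eq_zero_of_mem_opSpectrum hT hspec)⟩

end Weyl

section Transfer

theorem isSelfAdjoint_of_equiv {𝕜 E E' : Type*} [RCLike 𝕜] [NormedAddCommGroup E]
    [InnerProductSpace 𝕜 E] [CompleteSpace E] [NormedAddCommGroup E'] [InnerProductSpace 𝕜 E']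
    [CompleteSpace E'] {T : E →ₗ.[𝕜] E} {T' : E' →ₗ.[𝕜] E'} (hT : IsSelfAdjoint T)
    {J U : E' ≃L[𝕜] E} (hJU : ∀ f g : E', inner 𝕜 f g = inner 𝕜 (J f) (U g))
    {e : T'.domain ≃ T.domain} (he : ∀ f, (e f : E) = J f) (hTU : ∀ f, T (e f) = U (T' f)) :
    IsSelfAdjoint T' := by
  obtain ⟨hsymm, hmax⟩ := isSelfAdjoint_iff_isFormalAdjoint_and_forall_exists.1 hT
  have hUJ (f g : E') : inner 𝕜 f g = inner 𝕜 (U f) (J g) := by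
    rw [← inner_conj_symm, hJU, inner_conj_symm]
  refine isSelfAdjoint_iff_isFormalAdjoint_and_forall_exists.2 ⟨fun f g => ?_, fun g h hgh => ?_⟩
  · rw [hUJ, ← hTU, ← he, hsymm, he, hTU, hJU]
  · obtain ⟨hg, hTg⟩ := hmax (J g) (U h) fun f => by
      have hf := hgh (e.symm f)
      rwa [hUJ, ← hTU, hJU, ← he, e.apply_symm_apply] at hf
    have hg' : (e.symm ⟨J g, hg⟩ : E') = g := J.injective (by rw [← he, e.apply_symm_apply])
    refine ⟨hg' ▸ (e.symm ⟨J g, hg⟩).2, U.injective ?_⟩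
    rw [← hTU, ← hTg]
    congr 1
    exact Subtype.ext (he _)

section Normed

variable {E E' F F' : Type*} [NormedAddCommGroup E] [NormedSpace ℂ E] [NormedAddCommGroup E']
  [NormedSpace ℂ E'] [NormedAddCommGroup F] [NormedSpace ℂ F] [NormedAddCommGroup F']
  [NormedSpace ℂ F']

theorem noSingularSequence_congr {D : Submodule ℂ E} {D' : Submodule ℂ E'} {S : D →ₗ[ℂ] F}
    {S' : D' →ₗ[ℂ] F'} {J : E ≃L[ℂ] E'} {U : F ≃L[ℂ] F'} {e : D ≃ D'}
    (he : ∀ f, (e f : E') = J f) (hSU : ∀ f, S' (e f) = U (S f)) :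
    NoSingularSequence S ↔ NoSingularSequence S' := by
  constructor
  · intro h f hweak hlim
    have he_symm (n : ℕ) : (e.symm (f n) : E) = J.symm (f n) := by
      rw [J.eq_symm_apply, ← he, e.apply_symm_apply]
    have hSU_symm (n : ℕ) : S (e.symm (f n)) = U.symm (S' (f n)) := by
      rw [U.eq_symm_apply, ← hSU, e.apply_symm_apply]
    have hlim' := h (fun n => e.symm (f n))
      (by simpa [he_symm] using hweak.map J.symm.toContinuousLinearMap)
      (by simpa [hSU_symm, Function.comp_def] using (U.symm.continuous.tendsto 0).comp hlim)
    simpa [he_symm, Function.comp_def] using (J.continuous.tendsto 0).comp hlim'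
  · intro h f hweak hlim
    have hlim' := h (fun n => e (f n))
      (by simpa [he] using hweak.map J.toContinuousLinearMap)
      (by simpa [hSU, Function.comp_def] using (U.continuous.tendsto 0).comp hlim)
    simpa [he, Function.comp_def] using (J.symm.continuous.tendsto 0).comp hlim'

end Normed

variable {E F : Type*} [NormedAddCommGroup E] [InnerProductSpace ℂ E] [NormedAddCommGroup F]
  [NormedSpace ℂ F] {T : E →ₗ.[ℂ] E} {B B' : E →L[ℂ] E} {z : ℂ}

/-- Relative compactness of a bounded operator `K` with respect to `T`, in the sequential form:
`K` maps weakly null sequences which are bounded in the graph norm of `T` to null sequences. A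
weakly null sequence is bounded, so the bound on the graph norm amounts to one on `‖T (f n)‖`. -/
def IsRelativelyCompact (T : E →ₗ.[ℂ] E) (K : E →L[ℂ] F) : Prop :=
  ∀ f : ℕ → T.domain, WeakTendsto ℂ (fun n => (f n : E)) atTop 0 → (∃ C, ∀ n, ‖T (f n)‖ ≤ C) →
    Tendsto (fun n => K (f n)) atTop (𝓝 0)

theorem IsRelativelyCompact.neg {K : E →L[ℂ] F} (hK : IsRelativelyCompact T K) :
    IsRelativelyCompact T (-K) := fun f hweak hbound => by
  simpa only [neg_apply, neg_zero] using (hK f hweak hbound).neg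

theorem NoSingularSequence.of_isRelativelyCompact_sub (h : NoSingularSequence (pencil T B z))
    (hK : IsRelativelyCompact T (B - B')) : NoSingularSequence (pencil T B' z) := by
  intro f hweak hlim
  have hbound : ∃ C, ∀ n, ‖T (f n)‖ ≤ C := by
    obtain ⟨C₁, hC₁⟩ := hweak.exists_norm_le
    obtain ⟨C₂, hC₂⟩ := hlim.norm.bddAbove_range
    refine ⟨C₂ + ‖z • B'‖ * C₁, fun n => ?_⟩
    calc ‖T (f n)‖ = ‖pencil T B' z (f n) + (z • B') (f n)‖ := by
          rw [pencil_apply, smul_apply, sub_add_cancel]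
      _ ≤ C₂ + ‖z • B'‖ * C₁ :=
          norm_add_le_of_le (hC₂ ⟨n, rfl⟩) ((z • B').le_opNorm_of_le (hC₁ n))
  have hdiff : Tendsto (fun n => z • (B - B') (f n)) atTop (𝓝 0) := by
    simpa only [smul_zero] using (hK f hweak hbound).const_smul z
  have hlim' := hlim.sub hdiff
  rw [sub_zero] at hlim'
  refine h f hweak (hlim'.congr fun n => ?_)
  rw [pencil_apply, pencil_apply, sub_apply, smul_sub, sub_sub, add_sub_cancel]

theorem noSingularSequence_pencil_congr (hK : IsRelativelyCompact T (B - B')) :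
    NoSingularSequence (pencil T B z) ↔ NoSingularSequence (pencil T B' z) :=
  ⟨fun h => h.of_isRelativelyCompact_sub hK, fun h =>
    h.of_isRelativelyCompact_sub (by simpa only [neg_sub] using hK.neg)⟩

end Transfer

section Multiplication

variable {d k : ℕ} {B : Sp d → Matrix (Fin k) (Fin k) ℂ}

theorem coeFn_mulOp (f : (mulOp B).domain) :
    mulOp B f =ᵐ[volume] fun x => act (B x) ((f : L2 d k) x) :=
  coeFn_mulFun B f

theorem mulOp_eq_iff {f g : L2 d k} :
    (∃ hf : f ∈ (mulOp B).domain, mulOp B ⟨f, hf⟩ = g) ↔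
      g =ᵐ[volume] fun x => act (B x) (f x) := by
  constructor
  · rintro ⟨hf, rfl⟩
    exact coeFn_mulOp _
  · intro h
    have hf : f ∈ (mulOp B).domain := mem_mulDomain.2 ((Lp.memLp g).ae_eq h)
    exact ⟨hf, Lp.ext ((coeFn_mulOp _).trans h.symm)⟩

theorem inner_eq_of_ae_eq_act (hB : ∀ x, (B x).IsHermitian) {f g f' g' : L2 d k}
    (hf : f' =ᵐ[volume] fun x => act (B x) (f x)) (hg : g' =ᵐ[volume] fun x => act (B x) (g x)) :
    inner ℂ f' g = inner ℂ f g' := by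
  rw [L2.inner_def, L2.inner_def]
  refine integral_congr_ae ?_
  filter_upwards [hf, hg] with x hfx hgx
  rw [hfx, hgx, inner_act_symm (hB x)]

/-- Multiplication by a bounded matrix-function as a bounded operator on `L₂`. -/
def mulCLM (hB : ∀ i j, AEMeasurable (fun x => B x i j) volume) {C : ℝ}
    (hC : ∀ x v, ‖act (B x) v‖ ≤ C * ‖v‖) : L2 d k →L[ℂ] L2 d k :=
  LinearMap.mkContinuous
    ((mulOp B).toFun ∘ₗ LinearMap.codRestrict _ LinearMap.id fun f => memLp_act hB hC f) C
    fun f => Lp.norm_le_mul_norm_of_ae_le_mul <| by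
      filter_upwards [coeFn_mulOp (B := B) ⟨f, memLp_act hB hC f⟩] with x hx
      exact (congrArg norm hx).trans_le (hC x _)

theorem coeFn_mulCLM (hB : ∀ i j, AEMeasurable (fun x => B x i j) volume) {C : ℝ}
    (hC : ∀ x v, ‖act (B x) v‖ ≤ C * ‖v‖) (f : L2 d k) :
    mulCLM hB hC f =ᵐ[volume] fun x => act (B x) (f x) :=
  coeFn_mulOp _

theorem act_smul (c : ℂ) (B : Matrix (Fin k) (Fin k) ℂ) (v : EuclideanSpace ℂ (Fin k)) :
    act (c • B) v = c • act B v := by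
  rw [act, map_smul, smul_apply]

theorem act_smul_one (c : ℂ) (v : EuclideanSpace ℂ (Fin k)) :
    act (c • (1 : Matrix (Fin k) (Fin k) ℂ)) v = c • v := by
  rw [act_smul, act, map_one, one_apply_eq_self]

/-- Multiplication by a scalar function of modulus at most one. -/
def scalarMul (k : ℕ) {φ : Sp d → ℂ} (hφ : AEMeasurable φ volume) (hφ_le : ∀ x, ‖φ x‖ ≤ 1) :
    L2 d k →L[ℂ] L2 d k :=
  mulCLM (B := fun x => φ x • 1) (C := 1) (fun _ _ => hφ.mul_const _) fun x v => by
    rw [act_smul_one, norm_smul]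
    gcongr
    exact hφ_le x

section ScalarMul

variable {φ : Sp d → ℂ} (hφ : AEMeasurable φ volume) (hφ_le : ∀ x, ‖φ x‖ ≤ 1) (f : L2 d k)

theorem coeFn_scalarMul : scalarMul k hφ hφ_le f =ᵐ[volume] fun x => φ x • f x := by
  filter_upwards [coeFn_mulCLM (B := fun x => φ x • 1) _ _ f] with x hx
  exact hx.trans (act_smul_one _ _)

theorem norm_scalarMul_le : ‖scalarMul k hφ hφ_le f‖ ≤ ‖f‖ := by
  refine Lp.norm_le_norm_of_ae_le ?_
  filter_upwards [coeFn_scalarMul hφ hφ_le f] with x hx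
  rw [hx, norm_smul]
  exact mul_le_of_le_one_left (norm_nonneg _) (hφ_le x)

end ScalarMul

/-- The weight `(1 + ‖B(x)‖)⁻¹`: it is positive, and both it and its product with `B` are bounded.
It maps all of `L₂` into the maximal domain of multiplication by `B`. -/
def damping (B : Sp d → Matrix (Fin k) (Fin k) ℂ) (x : Sp d) : ℂ :=
  ((1 + ‖act (B x)‖ : ℝ) : ℂ)⁻¹

theorem norm_damping (x : Sp d) : ‖damping B x‖ = (1 + ‖act (B x)‖)⁻¹ := by
  rw [damping, norm_inv, Complex.norm_real, Real.norm_of_nonneg (by positivity)]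

theorem damping_ne_zero (x : Sp d) : damping B x ≠ 0 := by
  rw [← norm_ne_zero_iff, norm_damping]
  positivity

theorem norm_damping_le_one (x : Sp d) : ‖damping B x‖ ≤ 1 := by
  rw [norm_damping]
  exact inv_le_one_of_one_le₀ (le_add_of_nonneg_right (norm_nonneg _))

theorem norm_act_damping_smul_le (x : Sp d) (v : EuclideanSpace ℂ (Fin k)) :
    ‖act (damping B x • B x) v‖ ≤ 1 * ‖v‖ := by
  rw [act_smul, norm_smul, norm_damping, one_mul, inv_mul_le_iff₀ (by positivity)]
  exact (act (B x)).le_of_opNorm_le (le_add_of_nonneg_left zero_le_one) v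

theorem continuous_act : Continuous fun B : Matrix (Fin k) (Fin k) ℂ => act B :=
  (Matrix.toEuclideanCLM (n := Fin k) (𝕜 := ℂ)).toAlgEquiv.toLinearMap
    |>.continuous_of_finiteDimensional

theorem aemeasurable_damping (hB : ∀ i j, AEMeasurable (fun x => B x i j) volume) :
    AEMeasurable (damping B) volume := by
  have hB' : AEMeasurable (fun x => (fun i j => B x i j : Fin k → Fin k → ℂ)) volume :=
    aemeasurable_pi_lambda _ fun i => aemeasurable_pi_lambda _ fun j => hB i j
  have hnorm : Continuous fun B : Fin k → Fin k → ℂ => ‖act (Matrix.of B)‖ :=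
    (continuous_act (k := k)).norm
  exact (Complex.measurable_ofReal.comp_aemeasurable
    ((hnorm.measurable.comp_aemeasurable hB').const_add 1)).inv

theorem isHermitian_damping_smul {C : Matrix (Fin k) (Fin k) ℂ} (hC : C.IsHermitian)
    (x : Sp d) : (damping B x • C).IsHermitian := by
  rw [Matrix.IsHermitian, Matrix.conjTranspose_smul, hC.eq, damping, ← Complex.ofReal_inv,
    Complex.star_def, Complex.conj_ofReal]

theorem isFormalAdjoint_mulOp (hB : ∀ x, (B x).IsHermitian) :
    (mulOp B).IsFormalAdjoint (mulOp B) :=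
  fun f g => inner_eq_of_ae_eq_act hB (coeFn_mulOp f) (coeFn_mulOp g)

theorem isSelfAdjoint_mulOp (hB : ∀ i j, AEMeasurable (fun x => B x i j) volume)
    (hB_herm : ∀ x, (B x).IsHermitian) : IsSelfAdjoint (mulOp B) := by
  refine isSelfAdjoint_iff_isFormalAdjoint_and_forall_exists.2
    ⟨isFormalAdjoint_mulOp hB_herm, fun g h hgh => mulOp_eq_iff.2 ?_⟩
  let W : L2 d k →L[ℂ] L2 d k := scalarMul k (aemeasurable_damping hB) norm_damping_le_one
  let S : L2 d k →L[ℂ] L2 d k := mulCLM (B := fun x => damping B x • B x)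
    (fun i j => (aemeasurable_damping hB).mul (hB i j)) norm_act_damping_smul_le
  have hW (u : L2 d k) : W u =ᵐ[volume] fun x => damping B x • u x := coeFn_scalarMul _ _ u
  have hS (u : L2 d k) : S u =ᵐ[volume] fun x => act (damping B x • B x) (u x) :=
    coeFn_mulCLM _ _ u
  have hSW (u : L2 d k) : ∃ hu : W u ∈ (mulOp B).domain, mulOp B ⟨W u, hu⟩ = S u := by
    refine mulOp_eq_iff.2 ?_
    filter_upwards [hS u, hW u] with x hSx hWx
    rw [hSx, hWx, act_smul, map_smul]
  have hSg : S g = W h := by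
    refine ext_inner_left ℂ fun u => ?_
    obtain ⟨hu, hSu⟩ := hSW u
    calc inner ℂ u (S g) = inner ℂ (S u) g :=
          (inner_eq_of_ae_eq_act (fun x => isHermitian_damping_smul (hB_herm x) x)
            (hS u) (hS g)).symm
      _ = inner ℂ (W u) h := by rw [← hSu]; exact hgh ⟨W u, hu⟩
      _ = inner ℂ u (W h) := inner_eq_of_ae_eq_act (B := fun x => damping B x • 1)
          (fun x => isHermitian_damping_smul Matrix.isHermitian_one x)
          (by simpa only [act_smul_one] using hW u) (by simpa only [act_smul_one] using hW h)
  filter_upwards [hS g, hSg ▸ hW h] with x hSx hWx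
  rw [hSx, act_smul] at hWx
  exact (smul_right_injective _ (damping_ne_zero x) hWx).symm

theorem aemeasurable_comp_smul {f : Sp d → ℂ} (hf : AEMeasurable f volume) {r : ℝ} (hr : r ≠ 0) :
    AEMeasurable (fun ξ => f (r • ξ)) volume := by
  refine hf.comp_quasiMeasurePreserving ⟨measurable_const_smul r, ?_⟩
  rw [Measure.map_addHaar_smul _ hr]
  exact Measure.smul_absolutelyContinuous

/-- The unitary Fourier transform on `L₂`, with the kernel `exp(-2πi⟨x, ξ⟩)`. -/
abbrev fourierL2 (d k : ℕ) : L2 d k ≃ₗᵢ[ℂ] L2 d k :=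
  Lp.fourierTransformₗᵢ (Sp d) (EuclideanSpace ℂ (Fin k))

variable {A : Sp d → Matrix (Fin k) (Fin k) ℂ}

theorem fourierL2_pseudoDiffOp (f : (pseudoDiffOp A).domain) :
    fourierL2 d k (pseudoDiffOp A f) =
      mulOp (fun ξ => A ((2 * Real.pi) • ξ)) ⟨fourierL2 d k f, f.2⟩ :=
  (fourierL2 d k).apply_symm_apply _

theorem isSelfAdjoint_pseudoDiffOp (hA : ∀ i j, AEMeasurable (fun ξ => A ξ i j) volume)
    (hA_herm : ∀ ξ, (A ξ).IsHermitian) : IsSelfAdjoint (pseudoDiffOp A) := by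
  have hmul : IsSelfAdjoint (mulOp fun ξ => A ((2 * Real.pi) • ξ)) :=
    isSelfAdjoint_mulOp (fun i j => aemeasurable_comp_smul (hA i j) Real.two_pi_pos.ne')
      fun ξ => hA_herm _
  let F := (fourierL2 d k).toContinuousLinearEquiv
  exact isSelfAdjoint_of_equiv hmul (J := F) (U := F)
    (fun f g => ((fourierL2 d k).inner_map_map f g).symm)
    (e := F.toEquiv.subtypeEquiv fun _ => Iff.rfl) (fun _ => rfl)
    fun f => (fourierL2_pseudoDiffOp f).symm

end Multiplication

section Weighted

variable {d k : ℕ} (M : Medium d k)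

namespace Medium

theorem act_mul_act_inv (x : Sp d) (v : EuclideanSpace ℂ (Fin k)) :
    act (M.mat x) (act (M.mat x)⁻¹ v) = v := by
  rw [← mul_apply_eq_comp, act, act, ← map_mul, Matrix.mul_nonsing_inv _ (M.isUnit_det x),
    map_one, one_apply_eq_self]

theorem act_inv_mul_act (x : Sp d) (v : EuclideanSpace ℂ (Fin k)) :
    act (M.mat x)⁻¹ (act (M.mat x) v) = v := by
  rw [← mul_apply_eq_comp, act, act, ← map_mul, Matrix.nonsing_inv_mul _ (M.isUnit_det x),
    map_one, one_apply_eq_self]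

theorem coeFn_mulInv (f : L2 d k) : M.mulInv f =ᵐ[volume] fun x => act (M.mat x)⁻¹ (f x) :=
  coeFn_mulOp _

/-- Multiplication by `M(x)`, as an automorphism of `L₂`. -/
def mulEquiv : L2 d k ≃L[ℂ] L2 d k :=
  let mulMat := mulCLM M.aemeasurable M.exists_norm_act_le.choose_spec
  have hmulMat (f : L2 d k) : mulMat f =ᵐ[volume] fun x => act (M.mat x) (f x) :=
    coeFn_mulCLM _ _ f
  { toLinearEquiv := LinearEquiv.ofLinearMap mulMat M.mulInv
      (LinearMap.ext fun f => Lp.ext <| by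
        filter_upwards [hmulMat (M.mulInv f), M.coeFn_mulInv f] with x hx hx_inv
        exact hx.trans (hx_inv ▸ M.act_mul_act_inv x _))
      (LinearMap.ext fun f => Lp.ext <| by
        filter_upwards [hmulMat f, M.coeFn_mulInv (mulMat f)] with x hx hx_inv
        exact hx_inv.trans (hx ▸ M.act_inv_mul_act x _))
    continuous_toFun := mulMat.continuous
    continuous_invFun :=
      (mulCLM M.aemeasurable_inv M.exists_norm_act_inv_le.choose_spec).continuous }

theorem coeFn_mulEquiv (f : L2 d k) : M.mulEquiv f =ᵐ[volume] fun x => act (M.mat x) (f x) :=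
  coeFn_mulCLM M.aemeasurable M.exists_norm_act_le.choose_spec f

end Medium

namespace WeightedL2

theorem inner_eq (f g : WeightedL2 M) :
    inner ℂ f g = inner ℂ (toL2 M f) (M.mulEquiv (toL2 M g)) := by
  change weightedInner M (toL2 M f) (toL2 M g) = _
  rw [weightedInner, L2.inner_def]
  refine integral_congr_ae ?_
  filter_upwards [M.coeFn_mulEquiv (toL2 M g)] with x hx
  rw [hx]

theorem exists_norm_le : ∃ C : ℝ, ∀ f : WeightedL2 M, ‖f‖ ≤ C * ‖toL2 M f‖ := by
  let S : L2 d k →L[ℂ] L2 d k := M.mulEquiv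
  refine ⟨√‖S‖, fun f => le_of_sq_le_sq ?_ (by positivity)⟩
  calc ‖f‖ ^ 2 = RCLike.re (inner ℂ (toL2 M f) (S (toL2 M f))) := by
        rw [← inner_self_eq_norm_sq (𝕜 := ℂ), inner_eq]
        rfl
    _ ≤ ‖toL2 M f‖ * (‖S‖ * ‖toL2 M f‖) :=
        (re_inner_le_norm _ _).trans (by gcongr; exact S.le_opNorm _)
    _ = (√‖S‖ * ‖toL2 M f‖) ^ 2 := by
        rw [mul_pow, Real.sq_sqrt (norm_nonneg _)]
        ring

theorem exists_norm_toL2_le : ∃ C : ℝ, ∀ f : WeightedL2 M, ‖toL2 M f‖ ≤ C * ‖f‖ := by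
  obtain ⟨c₀, _, hc₀, hM⟩ := M.bounds
  refine ⟨(√c₀)⁻¹, fun f => ?_⟩
  rw [inv_mul_eq_div, le_div_iff₀' (Real.sqrt_pos.2 hc₀)]
  refine le_of_sq_le_sq ?_ (norm_nonneg f)
  calc (√c₀ * ‖toL2 M f‖) ^ 2 = ∫ x, c₀ * RCLike.re (inner ℂ (toL2 M f x) (toL2 M f x)) := by
        rw [mul_pow, Real.sq_sqrt hc₀.le, ← inner_self_eq_norm_sq (𝕜 := ℂ), L2.inner_def,
          ← integral_re (L2.integrable_inner _ _), ← integral_const_mul]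
    _ ≤ ∫ x, RCLike.re (inner ℂ (toL2 M f x) (act (M.mat x) (toL2 M f x))) := by
        refine integral_mono ((L2.integrable_inner _ _).re.const_mul _)
          (integrable_weightedInner M _ _).re fun x => ?_
        simpa only [inner_self_eq_norm_sq] using inner_act_ge (hM x).1 (toL2 M f x)
    _ = ‖f‖ ^ 2 := by
        rw [← re_weightedInner_self, ← inner_self_eq_norm_sq (𝕜 := ℂ)]
        rfl

/-- The identical mapping of `𝓗` onto `L₂(ℝᵈ; ℂᵏ)`, as an isomorphism of normed spaces (it is not
isometric). -/
def toL2CLE : WeightedL2 M ≃L[ℂ] L2 d k where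
  toLinearEquiv := toL2 M
  continuous_toFun :=
    ((toL2 M).toLinearMap.mkContinuous _ (exists_norm_toL2_le M).choose_spec).continuous
  continuous_invFun :=
    ((toL2 M).symm.toLinearMap.mkContinuous _
      fun f => (exists_norm_le M).choose_spec ((toL2 M).symm f)).continuous

instance : CompleteSpace (WeightedL2 M) :=
  (completeSpace_congr (e := (toL2CLE M).toEquiv) (toL2CLE M).isUniformEmbedding).2 inferInstance

end WeightedL2

variable {A : Sp d → Matrix (Fin k) (Fin k) ℂ}

/-- The identical mapping of `𝓓(H)` onto `𝓓(P(D))`. -/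
def mediumOpDomainEquiv (A : Sp d → Matrix (Fin k) (Fin k) ℂ) :
    (mediumOp M A).domain ≃ (pseudoDiffOp A).domain :=
  (WeightedL2.toL2CLE M).toEquiv.subtypeEquiv fun _ => Iff.rfl

theorem pseudoDiffOp_mediumOpDomainEquiv (f : (mediumOp M A).domain) :
    pseudoDiffOp A (mediumOpDomainEquiv M A f) =
      M.mulEquiv (WeightedL2.toL2CLE M (mediumOp M A f)) :=
  (M.mulEquiv.apply_symm_apply _).symm

theorem isSelfAdjoint_mediumOp (hA : ∀ i j, AEMeasurable (fun ξ => A ξ i j) volume)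
    (hA_herm : ∀ ξ, (A ξ).IsHermitian) : IsSelfAdjoint (mediumOp M A) :=
  isSelfAdjoint_of_equiv (isSelfAdjoint_pseudoDiffOp hA hA_herm) (J := WeightedL2.toL2CLE M)
    (U := (WeightedL2.toL2CLE M).trans M.mulEquiv) (WeightedL2.inner_eq M)
    (e := mediumOpDomainEquiv M A) (fun _ => rfl) (pseudoDiffOp_mediumOpDomainEquiv M)

theorem noSingularSequence_pencil_mediumOp_iff {z : ℂ} :
    NoSingularSequence (pencil (mediumOp M A) 1 z) ↔
      NoSingularSequence (pencil (pseudoDiffOp A) M.mulEquiv z) := by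
  refine noSingularSequence_congr (J := WeightedL2.toL2CLE M)
    (U := (WeightedL2.toL2CLE M).trans M.mulEquiv) (e := mediumOpDomainEquiv M A)
    (fun _ => rfl) fun f => ?_
  rw [pencil_apply, pencil_one_apply, pseudoDiffOp_mediumOpDomainEquiv, map_sub, map_smul]
  rfl

end Weighted

section LocalCompactness

section FourierInversion

variable {V H : Type*} [NormedAddCommGroup V] [InnerProductSpace ℝ V] [FiniteDimensional ℝ V]
  [MeasurableSpace V] [BorelSpace V] [NormedAddCommGroup H] [InnerProductSpace ℂ H]
  [CompleteSpace H]

theorem integral_fourierInv_smul_eq (φ : SchwartzMap V ℂ) {v : V → H} (hv : Integrable v) :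
    ∫ ξ, (𝓕⁻ φ) ξ • v ξ = ∫ x, φ x • (𝓕⁻ v) x := by
  have hflip : (-innerₗ V).flip = -innerₗ V := by
    ext x y
    simp [real_inner_comm]
  have h := VectorFourier.integral_fourierIntegral_smul_eq_flip (μ := volume) (ν := volume)
    (L := -innerₗ V) Real.continuous_fourierChar (by exact continuous_inner.neg) φ.integrable hv
  rw [hflip] at h
  rw [SchwartzMap.fourierInv_coe]
  exact h

theorem integral_smul_fourierTransform_symm (φ : SchwartzMap V ℂ) (v : Lp (α := V) H 2) :
    ∫ x, φ x • (Lp.fourierTransformₗᵢ V H).symm v x = ∫ ξ, (𝓕⁻ φ) ξ • v ξ := by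
  have h := congrArg (fun D => D φ) (Lp.fourierInv_toTemperedDistribution_eq v)
  simp only [TemperedDistribution.fourierInv_apply, Lp.toTemperedDistribution_apply] at h
  exact h.symm

theorem fourierTransform_symm_ae_eq {v : Lp (α := V) H 2} (hv : Integrable v) :
    (Lp.fourierTransformₗᵢ V H).symm v =ᵐ[volume] 𝓕⁻ (v : V → H) := by
  have hcont : Continuous (𝓕⁻ (v : V → H)) :=
    VectorFourier.fourierIntegral_continuous Real.continuous_fourierChar
      (L := -innerₗ V) (by exact continuous_inner.neg) hv
  refine ae_eq_of_integral_contDiff_smul_eq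
    ((Lp.memLp _).locallyIntegrable one_le_two) hcont.locallyIntegrable fun g hg hg_supp => ?_
  have hφ_supp : HasCompactSupport (Complex.ofRealCLM ∘ g) := hg_supp.comp_left rfl
  let φ : SchwartzMap V ℂ := hφ_supp.toSchwartzMap (by fun_prop)
  exact (integral_smul_fourierTransform_symm φ v).trans (integral_fourierInv_smul_eq φ hv)

end FourierInversion

section SetIntegral

variable {α 𝕜 E ι : Type*} [MeasurableSpace α] {μ : Measure α} [RCLike 𝕜] [NormedAddCommGroup E]
  [NormedSpace ℝ E] {s : Set α}

theorem norm_setIntegral_le {p : ℝ≥0∞} [hp : Fact (1 ≤ p)] (hμs : μ s ≠ ∞) (f : Lp E p μ) :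
    ‖∫ x in s, f x ∂μ‖ ≤ ‖f‖ * μ.real s ^ (1 - 1 / p.toReal) := by
  have hexp : 0 ≤ 1 - 1 / p.toReal := by
    rw [one_div, ← ENNReal.toReal_inv, sub_nonneg]
    exact ENNReal.toReal_le_of_le_ofReal zero_le_one
      (by simpa only [ENNReal.ofReal_one] using ENNReal.inv_le_one.2 hp.out)
  have hle : ‖∫ x in s, f x ∂μ‖ₑ ≤ eLpNorm f p μ * μ s ^ (1 - 1 / p.toReal) := calc
    ‖∫ x in s, f x ∂μ‖ₑ ≤ eLpNorm f 1 (μ.restrict s) :=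
      (enorm_integral_le_lintegral_enorm _).trans_eq eLpNorm_one_eq_lintegral_enorm.symm
    _ ≤ eLpNorm f p (μ.restrict s) * μ s ^ (1 - 1 / p.toReal) := by
      simpa using eLpNorm_le_eLpNorm_mul_rpow_measure_univ hp.out
        (Lp.aestronglyMeasurable f).restrict
    _ ≤ eLpNorm f p μ * μ s ^ (1 - 1 / p.toReal) := by
      gcongr
      exact Measure.restrict_le_self
  have hfin : eLpNorm f p μ * μ s ^ (1 - 1 / p.toReal) ≠ ∞ :=
    ENNReal.mul_ne_top (Lp.eLpNorm_ne_top f) (ENNReal.rpow_ne_top_of_nonneg hexp hμs)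
  simpa [Lp.norm_def, measureReal_def, ENNReal.toReal_rpow] using ENNReal.toReal_mono hfin hle

theorem WeakTendsto.tendsto_setIntegral [InnerProductSpace 𝕜 E] [FiniteDimensional 𝕜 E]
    {f : ι → Lp E 2 μ} {l : Filter ι} {g : Lp E 2 μ} (hf : WeakTendsto 𝕜 f l g)
    (hs : MeasurableSet s) (hμs : μ s ≠ ∞) :
    Tendsto (fun i => ∫ x in s, f i x ∂μ) l (𝓝 (∫ x in s, g x ∂μ)) := by
  have : CompleteSpace E := FiniteDimensional.complete 𝕜 E
  refine (weakTendsto_of_inner (𝕜 := 𝕜) fun y => ?_).tendsto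
  simpa only [L2.inner_indicatorConstLp_eq_inner_setIntegral] using
    hf.inner (indicatorConstLp 2 hs hμs y)

end SetIntegral

end LocalCompactness

section Cutoff

variable {d k : ℕ} {s t : Set (Sp d)}

/-- Multiplication by the indicator function of `s`. -/
def cutoff (k : ℕ) (hs : MeasurableSet s) : L2 d k →L[ℂ] L2 d k :=
  scalarMul k (φ := s.indicator 1) (aemeasurable_one.indicator hs) fun x =>
    (norm_indicator_le_norm_self 1 x).trans_eq norm_one

theorem coeFn_cutoff (hs : MeasurableSet s) (f : L2 d k) :
    cutoff k hs f =ᵐ[volume] s.indicator f := by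
  filter_upwards [coeFn_scalarMul _ _ f] with x hx
  rw [cutoff, hx]
  by_cases hxs : x ∈ s <;> simp [hxs]

theorem norm_cutoff_le (hs : MeasurableSet s) (f : L2 d k) : ‖cutoff k hs f‖ ≤ ‖f‖ :=
  norm_scalarMul_le _ _ f

theorem norm_sub_cutoff_le (hs : MeasurableSet s) {f g : L2 d k} {c : ℝ} (hc : 0 ≤ c)
    (hfg : ∀ᵐ x, x ∉ s → ‖f x‖ ≤ c * ‖g x‖) : ‖f - cutoff k hs f‖ ≤ c * ‖g‖ := by
  refine Lp.norm_le_mul_norm_of_ae_le_mul ?_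
  filter_upwards [Lp.coeFn_sub f (cutoff k hs f), coeFn_cutoff hs f, hfg] with x hsub hcut hx
  rw [hsub, Pi.sub_apply, hcut]
  by_cases hxs : x ∈ s
  · rw [Set.indicator_of_mem hxs, sub_self, norm_zero]
    positivity
  · rw [Set.indicator_of_notMem hxs, sub_zero]
    exact hx hxs

theorem norm_sq_eq_integral_norm_sq (f : L2 d k) : ‖f‖ ^ 2 = ∫ x, ‖f x‖ ^ 2 := by
  rw [← inner_self_eq_norm_sq (𝕜 := ℂ), L2.inner_def, ← integral_re (L2.integrable_inner _ _)]
  simp only [inner_self_eq_norm_sq]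

theorem tendsto_cutoff_of_dominated (ht : MeasurableSet t) (hμt : volume t ≠ ∞)
    {f : ℕ → L2 d k} {C : ℝ} (hbound : ∀ n, ∀ᵐ x, ‖f n x‖ ≤ C)
    (hlim : ∀ᵐ x, Tendsto (fun n => f n x) atTop (𝓝 0)) :
    Tendsto (fun n => cutoff k ht (f n)) atTop (𝓝 0) := by
  have hnorm_sq (n : ℕ) : ‖cutoff k ht (f n)‖ ^ 2 = ∫ x in t, ‖f n x‖ ^ 2 := by
    rw [norm_sq_eq_integral_norm_sq, ← integral_indicator ht]
    refine integral_congr_ae ?_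
    filter_upwards [coeFn_cutoff ht (f n)] with x hx
    by_cases hxt : x ∈ t <;> simp [hx, hxt]
  have hintegral : Tendsto (fun n => ∫ x in t, ‖f n x‖ ^ 2) atTop (𝓝 (∫ _ in t, (0 : ℝ))) := by
    refine tendsto_integral_of_dominated_convergence (fun _ => C ^ 2)
      (fun n => ((Lp.aestronglyMeasurable (f n)).norm.pow 2).restrict)
      (integrableOn_const hμt) (fun n => ae_restrict_of_ae ?_) (ae_restrict_of_ae ?_)
    · filter_upwards [hbound n] with x hx
      rw [norm_pow, norm_norm]
      gcongr
    · filter_upwards [hlim] with x hx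
      simpa using hx.norm.pow 2
  rw [tendsto_zero_iff_norm_tendsto_zero]
  simpa [← hnorm_sq] using hintegral.sqrt

/-- Multiplication by the character `exp(2πi⟨·, x⟩)`. -/
def modulate (k : ℕ) (x : Sp d) : L2 d k →L[ℂ] L2 d k :=
  scalarMul k (φ := fun ξ => Real.fourierChar (inner ℝ ξ x))
    (by fun_prop) fun _ => (Circle.norm_coe _).le

theorem coeFn_modulate (x : Sp d) (f : L2 d k) :
    modulate k x f =ᵐ[volume] fun ξ => Real.fourierChar (inner ℝ ξ x) • f ξ :=
  coeFn_scalarMul _ _ f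

theorem fourierL2_symm_cutoff_ae_eq (hs : MeasurableSet s) (hμs : volume s ≠ ∞) (v : L2 d k) :
    (fourierL2 d k).symm (cutoff k hs v) =ᵐ[volume] fun x => ∫ ξ in s, modulate k x v ξ := by
  have hint : Integrable (cutoff k hs v) :=
    ((integrableOn_Lp_of_measure_ne_top v one_le_two hμs).integrable_indicator hs).congr
      (coeFn_cutoff hs v).symm
  filter_upwards [fourierTransform_symm_ae_eq hint] with x hx
  rw [hx, Real.fourierInv_eq, ← integral_indicator hs]
  refine integral_congr_ae ?_
  filter_upwards [coeFn_cutoff hs v, coeFn_modulate x v] with ξ hcut hmod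
  rw [hcut]
  by_cases hξ : ξ ∈ s
  · rw [Set.indicator_of_mem hξ, Set.indicator_of_mem hξ, hmod]
  · rw [Set.indicator_of_notMem hξ, Set.indicator_of_notMem hξ, smul_zero]

theorem tendsto_cutoff_fourierL2_symm_cutoff (hs : MeasurableSet s) (hμs : volume s ≠ ∞)
    (ht : MeasurableSet t) (hμt : volume t ≠ ∞) {v : ℕ → L2 d k}
    (hv : WeakTendsto ℂ v atTop 0) :
    Tendsto (fun n => cutoff k ht ((fourierL2 d k).symm (cutoff k hs (v n)))) atTop (𝓝 0) := by
  obtain ⟨C, hC⟩ := hv.exists_norm_le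
  have hFv (n : ℕ) := fourierL2_symm_cutoff_ae_eq hs hμs (v n)
  refine tendsto_cutoff_of_dominated ht hμt
    (C := C * volume.real s ^ (1 - 1 / (2 : ℝ≥0∞).toReal)) (fun n => ?_) ?_
  · filter_upwards [hFv n] with x hx
    rw [hx]
    refine (norm_setIntegral_le hμs _).trans ?_
    gcongr
    exact (norm_scalarMul_le _ _ _).trans (hC n)
  · filter_upwards [ae_all_iff.2 hFv] with x hx
    simp only [hx]
    have hlim := (hv.map (modulate k x)).tendsto_setIntegral hs hμs
    rwa [map_zero, integral_eq_zero_of_ae (ae_restrict_of_ae (Lp.coeFn_zero _ _ _))] at hlim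

end Cutoff

section RelativeCompactness

variable {d k : ℕ} {A : Sp d → Matrix (Fin k) (Fin k) ℂ}

theorem nu_mul_norm_le (ξ : Sp d) (v : EuclideanSpace ℂ (Fin k)) :
    nu A ξ * ‖v‖ ≤ ‖act (A ξ) v‖ := by
  rcases eq_or_ne v 0 with rfl | hv
  · rw [norm_zero, mul_zero]
    exact norm_nonneg _
  · have hbdd : BddBelow (Set.range fun n : Metric.sphere (0 : EuclideanSpace ℂ (Fin k)) 1 =>
        ‖act (A ξ) n‖) := ⟨0, Set.forall_mem_range.2 fun _ => norm_nonneg _⟩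
    have hle := ciInf_le hbdd ⟨((‖v‖⁻¹ : ℝ) : ℂ) • v, by
      simpa using norm_smul_inv_norm (𝕜 := ℂ) hv⟩
    rwa [map_smul, norm_smul, Complex.norm_real, norm_inv, norm_norm, ← div_eq_inv_mul,
      le_div_iff₀ (norm_pos_iff.2 hv)] at hle

theorem StronglyCarleman.eventually_norm_le (hA : StronglyCarleman A) {ε : ℝ} (hε : 0 < ε) :
    ∀ᶠ ξ in cobounded (Sp d), ∀ v, ‖v‖ ≤ ε * ‖act (A ((2 * Real.pi) • ξ)) v‖ := by
  have hscale : Tendsto (fun ξ : Sp d => (2 * Real.pi) • ξ) (cobounded _) (cobounded _) := by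
    rw [← tendsto_norm_atTop_iff_cobounded]
    simp only [norm_smul, Real.norm_of_nonneg Real.two_pi_pos.le]
    exact tendsto_norm_cobounded_atTop.const_mul_atTop Real.two_pi_pos
  filter_upwards [(hA.comp hscale).eventually_ge_atTop ε⁻¹] with ξ hξ v
  rw [← inv_mul_le_iff₀ hε]
  exact (mul_le_mul_of_nonneg_right hξ (norm_nonneg v)).trans (nu_mul_norm_le _ v)

theorem StronglyCarleman.isRelativelyCompact_cutoff (hA : StronglyCarleman A) {t : Set (Sp d)}
    (ht : MeasurableSet t) (hμt : volume t ≠ ∞) :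
    IsRelativelyCompact (pseudoDiffOp A) (cutoff k ht) := by
  rintro f hweak ⟨C, hC⟩
  refine tendsto_zero_of_forall_exists_norm_sub_le fun δ hδ => ?_
  obtain ⟨ε, hε, hεδ⟩ := exists_pos_mul_lt hδ C
  obtain ⟨r, -, hr⟩ := (Metric.hasBasis_cobounded_compl_closedBall (0 : Sp d)).eventually_iff.1
    (hA.eventually_norm_le hε)
  let F := fourierL2 d k
  let lowFreq : L2 d k →L[ℂ] L2 d k :=
    cutoff k (Metric.isClosed_closedBall (x := (0 : Sp d)) (ε := r)).measurableSet
  have hhigh (n : ℕ) : ‖F (f n) - lowFreq (F (f n))‖ ≤ ε * ‖F (pseudoDiffOp A (f n))‖ := by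
    refine norm_sub_cutoff_le _ hε.le ?_
    rw [fourierL2_pseudoDiffOp]
    filter_upwards
      [coeFn_mulOp (B := fun ξ => A ((2 * Real.pi) • ξ)) ⟨F (f n), (f n).2⟩] with ξ hξ hξr
    rw [hξ]
    exact hr hξr _
  refine ⟨fun n => cutoff k ht (F.symm (lowFreq (F (f n)))),
    tendsto_cutoff_fourierL2_symm_cutoff _ Metric.isBounded_closedBall.measure_lt_top.ne ht hμt
      (by simpa using hweak.map F.toContinuousLinearEquiv.toContinuousLinearMap),
    Eventually.of_forall fun n => ?_⟩
  calc ‖cutoff k ht (f n) - cutoff k ht (F.symm (lowFreq (F (f n))))‖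
      = ‖cutoff k ht (F.symm (F (f n) - lowFreq (F (f n))))‖ := by
        rw [map_sub, F.symm_apply_apply, map_sub]
    _ ≤ ‖F (f n) - lowFreq (F (f n))‖ := (norm_cutoff_le ht _).trans_eq (F.symm.norm_map _)
    _ ≤ ε * ‖pseudoDiffOp A (f n)‖ := (hhigh n).trans_eq (by rw [F.norm_map])
    _ ≤ C * ε := (mul_le_mul_of_nonneg_left (hC n) hε.le).trans_eq (mul_comm _ _)
    _ ≤ δ := hεδ.le

theorem StronglyCarleman.isRelativelyCompact_of_tendsto_zero (hA : StronglyCarleman A)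
    {V : Sp d → Matrix (Fin k) (Fin k) ℂ} {K : L2 d k →L[ℂ] L2 d k}
    (hK : ∀ f, K f =ᵐ[volume] fun x => act (V x) (f x))
    (hV : Tendsto V (cobounded (Sp d)) (𝓝 0)) : IsRelativelyCompact (pseudoDiffOp A) K := by
  rintro f hweak ⟨C, hC⟩
  obtain ⟨C', hC'⟩ := hweak.exists_norm_le
  refine tendsto_zero_of_forall_exists_norm_sub_le fun δ hδ => ?_
  obtain ⟨ε, hε, hεδ⟩ := exists_pos_mul_lt hδ C'
  have hV_norm : Tendsto (fun x => ‖act (V x)‖) (cobounded (Sp d)) (𝓝 0) := by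
    simpa [act, Function.comp_def] using (continuous_act.norm.tendsto 0).comp hV
  obtain ⟨r, -, hr⟩ := (Metric.hasBasis_cobounded_compl_closedBall (0 : Sp d)).eventually_iff.1
    (hV_norm.eventually_le_const hε)
  have hball := (Metric.isClosed_closedBall (x := (0 : Sp d)) (ε := r)).measurableSet
  have hlocal := hA.isRelativelyCompact_cutoff (k := k) hball
    Metric.isBounded_closedBall.measure_lt_top.ne f hweak ⟨C, hC⟩
  refine ⟨fun n => K (cutoff k hball (f n)), ?_, Eventually.of_forall fun n => ?_⟩
  · simpa [Function.comp_def] using (K.continuous.tendsto 0).comp hlocal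
  have hcomm : K (cutoff k hball (f n)) = cutoff k hball (K (f n)) := by
    refine Lp.ext ?_
    filter_upwards [hK (cutoff k hball (f n)), hK (f n), coeFn_cutoff hball (f n : L2 d k),
      coeFn_cutoff hball (K (f n))] with x hKcut hKx hcut hcutK
    rw [hKcut, hcut, hcutK]
    by_cases hx : x ∈ Metric.closedBall 0 r <;> simp [hx, hKx]
  calc ‖K (f n) - K (cutoff k hball (f n))‖ = ‖K (f n) - cutoff k hball (K (f n))‖ := by
        rw [hcomm]
    _ ≤ ε * ‖(f n : L2 d k)‖ := by
        refine norm_sub_cutoff_le _ hε.le ?_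
        filter_upwards [hK (f n)] with x hx hxr
        rw [hx]
        exact (act (V x)).le_of_opNorm_le (hr hxr) _
    _ ≤ C' * ε := (mul_le_mul_of_nonneg_left (hC' n) hε.le).trans_eq (mul_comm _ _)
    _ ≤ δ := hεδ.le

theorem StronglyCarleman.isRelativelyCompact_mulEquiv_sub (hA : StronglyCarleman A)
    {M M₀ : Medium d k}
    (hV : Tendsto (fun x => M.mat x - M₀.mat x) (cobounded (Sp d)) (𝓝 0)) :
    IsRelativelyCompact (pseudoDiffOp A)
      ((M.mulEquiv : L2 d k →L[ℂ] L2 d k) - (M₀.mulEquiv : L2 d k →L[ℂ] L2 d k)) := by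
  refine hA.isRelativelyCompact_of_tendsto_zero (fun f => ?_) hV
  filter_upwards [M.coeFn_mulEquiv f, M₀.coeFn_mulEquiv f,
    Lp.coeFn_sub (M.mulEquiv f) (M₀.mulEquiv f)] with x hM hM₀ hsub
  exact hsub.trans (by rw [Pi.sub_apply, hM, hM₀, act, act, act, map_sub, sub_apply])

end RelativeCompactness

end MediumScattering

end

theorem proposition4p1 {d k : ℕ}
    (A : EuclideanSpace ℝ (Fin d) → Matrix (Fin k) (Fin k) ℂ)
    (hA_meas : ∀ i j, AEMeasurable (fun ξ => A ξ i j) volume)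
    (hA_herm : ∀ ξ, (A ξ).IsHermitian)
    (hA_carleman : MediumScattering.StronglyCarleman A)
    (M₀ M : MediumScattering.Medium d k)
    (hV : Tendsto (fun x => M.mat x - M₀.mat x) (cobounded (EuclideanSpace ℝ (Fin d))) (𝓝 0)) :
    MediumScattering.essentialSpectrum (MediumScattering.mediumOp M A) =
      MediumScattering.essentialSpectrum (MediumScattering.mediumOp M₀ A) := by
  ext z
  rw [← not_iff_not,
    MediumScattering.notMem_essentialSpectrum_iff
      (MediumScattering.isSelfAdjoint_mediumOp M hA_meas hA_herm),
    MediumScattering.notMem_essentialSpectrum_iff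
      (MediumScattering.isSelfAdjoint_mediumOp M₀ hA_meas hA_herm),
    MediumScattering.noSingularSequence_pencil_mediumOp_iff,
    MediumScattering.noSingularSequence_pencil_mediumOp_iff]
  exact MediumScattering.noSingularSequence_pencil_congr
    (hA_carleman.isRelativelyCompact_mulEquiv_sub hV)
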